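/- Let $a>0$, $c>0$, $t>0$ and $\rho\in[-1,1]$ be real, and exclude the degenerate case $\rho=1,\ c=2a$. Put $p(z)=(a-\rho c z)^2+c^2(z-z^2)$, $P(z)=\sqrt{p(z)}$, $$F(z)=\cosh\big(P(z)t/2\big)+(a-c\rho z)\,\frac{\sinh(P(z)t/2)}{P(z)},\qquad G(z)=\frac{(1-z)\,\sinh(P(z)t/2)/P(z)}{F(z)},$$ where $\cosh\sqrt{w}$ and $\sinh\sqrt{w}/\sqrt{w}$ are understood as the entire functions $\sum_{n\ge0} w^n/(2n)!$ and $\sum_{n\ge0} w^n/(2n+1)!$, so that $F$ is entire and $G$ is meromorphic on $\mathbb C$. Then $F(0)\neq0$, and the zeros of $F$ form an infinite sequence that can be ordered as $0<|a_1|\le|a_2|\le\cdots$, each zero being listed once. For every such ordering, the zeros $a_n$ are real and simple, they are simple poles of $G$, and the residues $b_n$ of $G$ at $a_n$ satisfy $$b_n>0\quad(n\ge1),\qquad \sum_{n\ge1}\frac{b_n}{a_n^2}<\infty .$$ For every $z\in\mathbb C\setminus\{a_n:n\ge1\}$, $$G(z)=\frac{1-e^{-at}}{2a}-z\sum_{n=1}^\infty\frac{b_n}{a_n^2\,(1-z/a_n)},$$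 where the series converges absolutely, and it converges uniformly on every compact subset of the disc $|z|<|a_1|$. -/

import Mathlib

open Filter Topology

noncomputable section

/-- The entire function `L₁(z) = ∑ zⁿ / (2n)!`, i.e. `cosh √z` for either branch of the root. -/
def coshSqrt (z : ℂ) : ℂ := ∑' n : ℕ, z ^ n / ((2 * n).factorial : ℂ)

/-- The entire function `L₂(z) = ∑ zⁿ / (2n+1)!`, i.e. `(sinh √z) / √z` for either branch of
the root, with value `1` at `0`. -/
def sinhcSqrt (z : ℂ) : ℂ := ∑' n : ℕ, z ^ n / ((2 * n + 1).factorial : ℂ)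

theorem coshSqrt_sq (w : ℂ) : coshSqrt (w ^ 2) = Complex.cosh w := by
  rw [Complex.cosh_eq_tsum, coshSqrt]
  simp only [pow_mul]

theorem mul_sinhcSqrt_sq (w : ℂ) : w * sinhcSqrt (w ^ 2) = Complex.sinh w := by
  rw [Complex.sinh_eq_tsum, sinhcSqrt, ← tsum_mul_left]
  refine tsum_congr fun n => ?_
  rw [← pow_mul, pow_succ]
  ring

namespace Heston

/-- The polynomial `p(z) = (a - ρcz)² + c²(z - z²)`. -/
def p (a c ρ : ℝ) (z : ℂ) : ℂ := (a - ρ * c * z) ^ 2 + c ^ 2 * (z - z ^ 2)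

/-- The entire function `sinh(P(z)t/2) / P(z)`, where `P = √p`. -/
def S (a c ρ t : ℝ) (z : ℂ) : ℂ := t / 2 * sinhcSqrt (p a c ρ z * (t / 2) ^ 2)

/-- The entire function `F(z) = cosh(P(z)t/2) + (a - cρz) sinh(P(z)t/2) / P(z)`. -/
def F (a c ρ t : ℝ) (z : ℂ) : ℂ :=
  coshSqrt (p a c ρ z * (t / 2) ^ 2) + (a - c * ρ * z) * S a c ρ t z

/-- The meromorphic function `G(z) = (1 - z) (sinh(P(z)t/2) / P(z)) / F(z)`
(only its values off the zeros of `F` matter). -/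
def G (a c ρ t : ℝ) (z : ℂ) : ℂ := (1 - z) * S a c ρ t z / F a c ρ t z

/-- For any choice of a nonzero square root `P` of `p(z)`, `S` is `sinh(Pt/2)/P`. -/
theorem S_eq (a c ρ t : ℝ) (z P : ℂ) (hP : P ^ 2 = p a c ρ z) (h0 : P ≠ 0) :
    S a c ρ t z = Complex.sinh (P * t / 2) / P := by
  rw [eq_div_iff h0, S, ← hP, ← mul_sinhcSqrt_sq,
    show (P * t / 2) ^ 2 = P ^ 2 * ((t : ℂ) / 2) ^ 2 by ring]
  ring

/-- For any choice of a nonzero square root `P` of `p(z)`, `F` is given by the usual formula. -/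
theorem F_eq (a c ρ t : ℝ) (z P : ℂ) (hP : P ^ 2 = p a c ρ z) (h0 : P ≠ 0) :
    F a c ρ t z =
      Complex.cosh (P * t / 2) + (a - c * ρ * z) * (Complex.sinh (P * t / 2) / P) := by
  rw [F, S_eq a c ρ t z P hP h0, ← hP, ← coshSqrt_sq,
    show (P * t / 2) ^ 2 = P ^ 2 * ((t : ℂ) / 2) ^ 2 by ring]

/-- `α 0, α 1, …` lists all complex zeros of `F`, each exactly once, by nondecreasing modulus. -/
structure IsZeroEnumeration (a c ρ t : ℝ) (α : ℕ → ℂ) : Prop where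
  injective : Function.Injective α
  range_eq : Set.range α = {z : ℂ | F a c ρ t z = 0}
  monotone_norm : Monotone fun n => ‖α n‖

end Heston

end

open Filter Topology

/-! Put T = t/2 and X = (1 - z)S, so that G = X/F at time T. In the time variable (X, F) solves a
linear system that is affine in z and starts at (0, 1). The coefficient of z is JH with J = [[0,
-1], [1, 0]] and H = [[c², -cρ], [-cρ, 1]], which is positive semidefinite because |ρ| ≤ 1. So this
is a canonical system and -G is a meromorphic Herglotz function.

The Lagrange identity `sub_mul_integral_formC` carries the spectral part. On the diagonal it says
that X ∂F/∂z is a positive energy at each real zero, so zeros are simple and the residue X/(∂F/∂z) =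
X²/energy is positive. Off the diagonal it makes the solutions at distinct zeros orthogonal.
Bessel's inequality for the solution at z = 0 then bounds the sum of b_n/a_n²
(`sum_residue_div_sq_le`).

A Lyapunov function (`exp_mul_normSq_flowX_le`) shows that F has no nonreal zero and that G is O(|z
- 1|²/|Im z|). There are infinitely many zeros because, outside the degenerate case, p tends to -∞
along a real half-line, where F keeps returning to the values 1 and -1 (`exists_zero_norm_gt`).

For the expansion, the difference of the two sides extends to an entire function H. The bound by
1/|Im z| forces linear growth of H, Liouville's theorem makes H(z)/z constant, and the constant is 0
because G(iy)/(iy) → 0 (`tendsto_flow_div_imag`). The constant term of the expansion is G(0). -/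

/-! ### The entire functions cosh √z and sinh √z / √z -/

theorem summable_pow_div_factorial {k : ℕ → ℕ} (hk : ∀ n, n ≤ k n) (r : ℝ) (hr : 0 ≤ r) :
    Summable fun n => r ^ n / ((k n).factorial : ℝ) := by
  refine Summable.of_nonneg_of_le (fun n => by positivity) (fun n => ?_)
    (Real.summable_pow_div_factorial r)
  have := Nat.factorial_le (hk n)
  gcongr

theorem differentiable_tsum_pow_div_factorial {k : ℕ → ℕ} (hk : ∀ n, n ≤ k n) :
    Differentiable ℂ fun z : ℂ => ∑' n, z ^ n / ((k n).factorial : ℂ) := by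
  intro z
  have hd : DifferentiableOn ℂ (fun z : ℂ => ∑' n, z ^ n / ((k n).factorial : ℂ))
      (Metric.ball 0 (‖z‖ + 1)) := by
    refine Complex.differentiableOn_tsum_of_summable_norm
      (summable_pow_div_factorial hk (‖z‖ + 1) (by positivity)) (fun n => by fun_prop)
      Metric.isOpen_ball fun n w hw => ?_
    rw [norm_div, norm_pow, Complex.norm_natCast]
    have : ‖w‖ ≤ ‖z‖ + 1 := (mem_ball_zero_iff.mp hw).le
    gcongr
  exact hd.differentiableAt (Metric.isOpen_ball.mem_nhds (by simp))

theorem differentiable_coshSqrt : Differentiable ℂ coshSqrt :=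
  differentiable_tsum_pow_div_factorial fun n => by omega

theorem differentiable_sinhcSqrt : Differentiable ℂ sinhcSqrt :=
  differentiable_tsum_pow_div_factorial fun n => by omega

theorem coshSqrt_conj (z : ℂ) :
    coshSqrt (starRingEnd ℂ z) = starRingEnd ℂ (coshSqrt z) := by
  rw [coshSqrt, coshSqrt, Complex.conj_tsum]
  simp

theorem sinhcSqrt_conj (z : ℂ) :
    sinhcSqrt (starRingEnd ℂ z) = starRingEnd ℂ (sinhcSqrt z) := by
  rw [sinhcSqrt, sinhcSqrt, Complex.conj_tsum]
  simp

theorem sinhcSqrt_zero : sinhcSqrt 0 = 1 := by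
  rw [sinhcSqrt, tsum_eq_single 0]
  · simp
  · intro n hn
    simp [hn]

/-- Writing q = P² turns the function into s ↦ cosh(Ps), so no branch of the root is needed. The
same device serves the next two lemmas. -/
theorem hasDerivAt_coshSqrt_mul_sq (q : ℂ) (s : ℝ) :
    HasDerivAt (fun s : ℝ => coshSqrt (q * (s : ℂ) ^ 2))
      (q * (s * sinhcSqrt (q * (s : ℂ) ^ 2))) s := by
  obtain ⟨P, rfl⟩ : ∃ P : ℂ, P ^ 2 = q := IsAlgClosed.exists_pow_nat_eq q two_pos
  have h : HasDerivAt (fun s : ℂ => Complex.cosh (P * s)) (Complex.sinh (P * s) * P) (s : ℂ) := by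
    simpa using ((hasDerivAt_id (s : ℂ)).const_mul P).ccosh
  convert h.comp_ofReal using 1
  · ext s
    rw [← mul_pow, coshSqrt_sq]
  · rw [← mul_pow, ← mul_sinhcSqrt_sq]
    ring

theorem hasDerivAt_mul_sinhcSqrt_mul_sq (q : ℂ) (s : ℝ) :
    HasDerivAt (fun s : ℝ => (s : ℂ) * sinhcSqrt (q * (s : ℂ) ^ 2))
      (coshSqrt (q * (s : ℂ) ^ 2)) s := by
  obtain ⟨P, rfl⟩ : ∃ P : ℂ, P ^ 2 = q := IsAlgClosed.exists_pow_nat_eq q two_pos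
  rcases eq_or_ne P 0 with rfl | hP
  · have h1 : coshSqrt 0 = 1 := by
      have := coshSqrt_sq 0
      simpa using this
    simpa [sinhcSqrt_zero, h1] using (hasDerivAt_id (s : ℂ)).comp_ofReal
  · have h : HasDerivAt (fun s : ℂ => Complex.sinh (P * s) / P) (Complex.cosh (P * s)) (s : ℂ) := by
      have h0 := (((hasDerivAt_id (s : ℂ)).const_mul P).csinh).div_const P
      simpa [hP] using h0
    convert h.comp_ofReal using 1
    · ext s
      rw [← mul_pow, ← mul_sinhcSqrt_sq]
      field_simp
    · rw [← mul_pow, coshSqrt_sq]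

theorem coshSqrt_sq_sub (q : ℂ) (s : ℝ) :
    coshSqrt (q * (s : ℂ) ^ 2) ^ 2 - q * (s * sinhcSqrt (q * (s : ℂ) ^ 2)) ^ 2 = 1 := by
  obtain ⟨P, rfl⟩ : ∃ P : ℂ, P ^ 2 = q := IsAlgClosed.exists_pow_nat_eq q two_pos
  have h := Complex.cosh_sq_sub_sinh_sq (P * s)
  rw [← mul_pow, coshSqrt_sq, ← h, ← mul_sinhcSqrt_sq]
  ring

/-! ### The flow (X, F) in the time variable -/

namespace Heston

/-- The value `sinh(P s) / P` at time `s`, as a function of the spectral parameter `z`. -/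
noncomputable def flowS (a c ρ : ℝ) (z : ℂ) (s : ℝ) : ℂ := s * sinhcSqrt (p a c ρ z * (s : ℂ) ^ 2)

/-- First component of the solution of the canonical system. -/
noncomputable def flowX (a c ρ : ℝ) (z : ℂ) (s : ℝ) : ℂ := (1 - z) * flowS a c ρ z s

/-- Second component of the solution of the canonical system. -/
noncomputable def flowF (a c ρ : ℝ) (z : ℂ) (s : ℝ) : ℂ :=
  coshSqrt (p a c ρ z * (s : ℂ) ^ 2) + (a - c * ρ * z) * flowS a c ρ z s

theorem S_eq_flowS (a c ρ t : ℝ) (z : ℂ) : S a c ρ t z = flowS a c ρ z (t / 2) := by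
  simp [S, flowS]

theorem F_eq_flowF (a c ρ t : ℝ) (z : ℂ) : F a c ρ t z = flowF a c ρ z (t / 2) := by
  simp [F, flowF, S_eq_flowS]

theorem G_eq_flow (a c ρ t : ℝ) (z : ℂ) :
    G a c ρ t z = flowX a c ρ z (t / 2) / flowF a c ρ z (t / 2) := by
  rw [G, F_eq_flowF, S_eq_flowS, flowX]

/-- With u = a - cρz one has p - u² = c²z(1 - z). Absorbing the factor 1 - z into X is what makes
the system for (X, F) affine in z. -/
theorem hasDerivAt_flowX (a c ρ : ℝ) (z : ℂ) (s : ℝ) :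
    HasDerivAt (flowX a c ρ z)
      (-(a - c * ρ * z) * flowX a c ρ z s + (1 - z) * flowF a c ρ z s) s := by
  have h : HasDerivAt (flowX a c ρ z) _ s :=
    (hasDerivAt_mul_sinhcSqrt_mul_sq (p a c ρ z) s).const_mul (1 - z)
  refine h.congr_deriv ?_
  simp only [flowX, flowF]
  ring

theorem hasDerivAt_flowF (a c ρ : ℝ) (z : ℂ) (s : ℝ) :
    HasDerivAt (flowF a c ρ z)
      (c ^ 2 * z * flowX a c ρ z s + (a - c * ρ * z) * flowF a c ρ z s) s := by
  have h : HasDerivAt (flowF a c ρ z) _ s := (hasDerivAt_coshSqrt_mul_sq (p a c ρ z) s).add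
    ((hasDerivAt_mul_sinhcSqrt_mul_sq (p a c ρ z) s).const_mul (a - c * ρ * z))
  refine h.congr_deriv ?_
  simp only [flowX, flowF, flowS, p]
  ring

theorem flowX_zero (a c ρ : ℝ) (z : ℂ) : flowX a c ρ z 0 = 0 := by
  simp [flowX, flowS]

theorem flowF_zero (a c ρ : ℝ) (z : ℂ) : flowF a c ρ z 0 = 1 := by
  have h1 : coshSqrt 0 = 1 := by
    have := coshSqrt_sq 0
    simpa using this
  simp [flowF, flowS, h1]

/-- If both vanished, so would the cosh term, against cosh² - sinh² = 1. -/
theorem flowF_ne_zero_of_flowS_eq_zero {a c ρ : ℝ} {z : ℂ} {s : ℝ} (h : flowS a c ρ z s = 0) :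
    flowF a c ρ z s ≠ 0 := by
  have h1 := coshSqrt_sq_sub (p a c ρ z) s
  rw [← flowS, h] at h1
  rw [flowF, h]
  intro h2
  rw [mul_zero, add_zero] at h2
  simp [h2] at h1

theorem p_conj (a c ρ : ℝ) (z : ℂ) : p a c ρ (starRingEnd ℂ z) = starRingEnd ℂ (p a c ρ z) := by
  simp [p]

theorem flowS_conj (a c ρ : ℝ) (z : ℂ) (s : ℝ) :
    flowS a c ρ (starRingEnd ℂ z) s = starRingEnd ℂ (flowS a c ρ z s) := by
  simp [flowS, p_conj, ← sinhcSqrt_conj]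

theorem flowX_conj (a c ρ : ℝ) (z : ℂ) (s : ℝ) :
    flowX a c ρ (starRingEnd ℂ z) s = starRingEnd ℂ (flowX a c ρ z s) := by
  simp [flowX, flowS_conj]

theorem flowF_conj (a c ρ : ℝ) (z : ℂ) (s : ℝ) :
    flowF a c ρ (starRingEnd ℂ z) s = starRingEnd ℂ (flowF a c ρ z s) := by
  simp [flowF, flowS_conj, p_conj, ← coshSqrt_conj]

theorem flowX_ofReal_im (a c ρ x s : ℝ) : (flowX a c ρ x s).im = 0 := by
  rw [← Complex.conj_eq_iff_im, ← flowX_conj, Complex.conj_ofReal]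

theorem flowF_ofReal_im (a c ρ x s : ℝ) : (flowF a c ρ x s).im = 0 := by
  rw [← Complex.conj_eq_iff_im, ← flowF_conj, Complex.conj_ofReal]

theorem differentiable_flowS (a c ρ s : ℝ) : Differentiable ℂ fun z => flowS a c ρ z s := by
  unfold flowS p
  exact (differentiable_sinhcSqrt.comp (by fun_prop)).const_mul _

theorem differentiable_flowX (a c ρ s : ℝ) : Differentiable ℂ fun z => flowX a c ρ z s := by
  unfold flowX
  exact Differentiable.mul (by fun_prop) (differentiable_flowS a c ρ s)

theorem differentiable_flowF (a c ρ s : ℝ) : Differentiable ℂ fun z => flowF a c ρ z s := by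
  have h := differentiable_flowS a c ρ s
  unfold flowF
  refine Differentiable.add ?_ (Differentiable.mul (by fun_prop) h)
  unfold p
  exact differentiable_coshSqrt.comp (by fun_prop)

theorem continuous_flowS (a c ρ : ℝ) : Continuous fun q : ℂ × ℝ => flowS a c ρ q.1 q.2 := by
  unfold flowS p
  exact Continuous.mul (by fun_prop) (differentiable_sinhcSqrt.continuous.comp (by fun_prop))

theorem continuous_flowX (a c ρ : ℝ) : Continuous fun q : ℂ × ℝ => flowX a c ρ q.1 q.2 := by
  exact (continuous_const.sub continuous_fst).mul (continuous_flowS a c ρ)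

theorem continuous_flowF (a c ρ : ℝ) : Continuous fun q : ℂ × ℝ => flowF a c ρ q.1 q.2 := by
  have h : Continuous fun q : ℂ × ℝ => coshSqrt (p a c ρ q.1 * (q.2 : ℂ) ^ 2) := by
    unfold p
    exact differentiable_coshSqrt.continuous.comp (by fun_prop)
  have h2 : Continuous fun q : ℂ × ℝ => (a : ℂ) - c * ρ * q.1 := by fun_prop
  exact h.add (h2.mul (continuous_flowS a c ρ))

theorem continuous_flowX_time (a c ρ : ℝ) (z : ℂ) : Continuous (flowX a c ρ z) :=
  continuous_iff_continuousAt.2 fun s => (hasDerivAt_flowX a c ρ z s).continuousAt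

theorem continuous_flowF_time (a c ρ : ℝ) (z : ℂ) : Continuous (flowF a c ρ z) :=
  continuous_iff_continuousAt.2 fun s => (hasDerivAt_flowF a c ρ z s).continuousAt

end Heston

/-! ### Lyapunov bound off the real axis -/

theorem HasDerivAt.complex_re_part {f : ℝ → ℂ} {f' : ℂ} {s : ℝ} (h : HasDerivAt f f' s) :
    HasDerivAt (fun s => (f s).re) f'.re s :=
  Complex.reCLM.hasFDerivAt.comp_hasDerivAt s h

theorem HasDerivAt.complex_im_part {f : ℝ → ℂ} {f' : ℂ} {s : ℝ} (h : HasDerivAt f f' s) :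
    HasDerivAt (fun s => (f s).im) f'.im s :=
  Complex.imCLM.hasFDerivAt.comp_hasDerivAt s h

namespace Heston

/-- Pointwise inequality behind the monotonicity of the Lyapunov function in
`exp_mul_normSq_flowX_le`. -/
theorem lyapunov_deriv_nonneg {c ρ k w1 w2 x1 x2 f1 f2 y e : ℝ}
    (hρ : ρ ∈ Set.Icc (-1 : ℝ) 1) (hy : 0 ≤ y) (he : 0 ≤ e) (he1 : e ≤ 1) :
    0 ≤ (w1 ^ 2 + w2 ^ 2) * (y * (c ^ 2 * (x1 ^ 2 + x2 ^ 2) - 2 * c * ρ * (x1 * f1 + x2 * f2)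
        + (f1 ^ 2 + f2 ^ 2)))
      - y * (e * (-(2 * |k| + 1)) * (x1 ^ 2 + x2 ^ 2) + e * (2 * k * (x1 ^ 2 + x2 ^ 2)
        + 2 * ((w1 * (c * ρ * x1 - f1) - w2 * (c * ρ * x2 - f2)) * x1
          + (w1 * (c * ρ * x2 - f2) + w2 * (c * ρ * x1 - f1)) * x2))) := by
  have h1 : 0 ≤ 1 - ρ ^ 2 := by nlinarith [hρ.1, hρ.2]
  -- The variable v = cρx - f diagonalises the form as c²(1 - ρ²)|x|² + |v|². The expression then
  -- splits into four nonnegative terms, the last being the completed square |wv - x|².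
  set v1 := c * ρ * x1 - f1 with hv1
  set v2 := c * ρ * x2 - f2 with hv2
  have hf1 : f1 = c * ρ * x1 - v1 := by rw [hv1]; ring
  have hf2 : f2 = c * ρ * x2 - v2 := by rw [hv2]; ring
  have hform : c ^ 2 * (x1 ^ 2 + x2 ^ 2) - 2 * c * ρ * (x1 * f1 + x2 * f2) + (f1 ^ 2 + f2 ^ 2)
      = c ^ 2 * (1 - ρ ^ 2) * (x1 ^ 2 + x2 ^ 2) + (v1 ^ 2 + v2 ^ 2) := by
    rw [hf1, hf2]; ring
  rw [hform]
  have hk := le_abs_self k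
  have hA : 0 ≤ y * ((w1 ^ 2 + w2 ^ 2) * (c ^ 2 * (1 - ρ ^ 2) * (x1 ^ 2 + x2 ^ 2))) := by
    positivity
  have hB : 0 ≤ y * ((1 - e) * ((w1 ^ 2 + w2 ^ 2) * (v1 ^ 2 + v2 ^ 2))) :=
    mul_nonneg hy (mul_nonneg (by linarith) (by positivity))
  have hC : 0 ≤ y * (e * ((|k| - k) * (x1 ^ 2 + x2 ^ 2))) :=
    mul_nonneg hy (mul_nonneg he (mul_nonneg (by linarith) (by positivity)))
  have hD : 0 ≤ y * (e * ((w1 * v1 - w2 * v2 - x1) ^ 2 + (w1 * v2 + w2 * v1 - x2) ^ 2)) := by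
    positivity
  linear_combination hA + hB + 2 * hC + hD

/-- The derivative of Im(conj X · F) is Im z times the Hamiltonian form, but for ρ² = 1 that form
only controls v = cρX - F. Control of |X|² comes from X' = (cρ - a)X + (z - 1)v: by Young's
inequality |X|² grows at rate at most 2|cρ - a| + 1, up to |z - 1|²|v|². The exponential weight
absorbs this rate. -/
theorem exp_mul_normSq_flowX_le {a c ρ : ℝ} (hρ : ρ ∈ Set.Icc (-1 : ℝ) 1) {z : ℂ}
    (hz : 0 < z.im) {s : ℝ} (hs : 0 ≤ s) :
    z.im * (Real.exp (-(2 * |c * ρ - a| + 1) * s) * ‖flowX a c ρ z s‖ ^ 2) ≤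
      ‖z - 1‖ ^ 2 * (‖flowX a c ρ z s‖ * ‖flowF a c ρ z s‖) := by
  set X := flowX a c ρ z with hX
  set F := flowF a c ρ z with hF
  set l := 2 * |c * ρ - a| + 1 with hl
  have hl0 : 0 < l := by positivity
  have hXd := hasDerivAt_flowX a c ρ z
  have hFd := hasDerivAt_flowF a c ρ z
  rw [← hX, ← hF] at hXd
  rw [← hX, ← hF] at hFd
  have hE : ∀ s : ℝ, HasDerivAt (fun s => Real.exp (-l * s)) (Real.exp (-l * s) * (-l)) s := by
    intro s
    simpa using ((hasDerivAt_id s).const_mul (-l)).exp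
  set Ψ : ℝ → ℝ := fun s =>
    ((z.re - 1) ^ 2 + z.im ^ 2) * ((X s).re * (F s).im - (X s).im * (F s).re)
      - z.im * (Real.exp (-l * s) * ((X s).re ^ 2 + (X s).im ^ 2)) with hΨ
  have hΨd : ∀ s, HasDerivAt Ψ
      (((z.re - 1) ^ 2 + z.im ^ 2) * (z.im * (c ^ 2 * ((X s).re ^ 2 + (X s).im ^ 2)
        - 2 * c * ρ * ((X s).re * (F s).re + (X s).im * (F s).im)
        + ((F s).re ^ 2 + (F s).im ^ 2)))
      - z.im * (Real.exp (-l * s) * (-(2 * |c * ρ - a| + 1)) * ((X s).re ^ 2 + (X s).im ^ 2)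
        + Real.exp (-l * s) * (2 * (c * ρ - a) * ((X s).re ^ 2 + (X s).im ^ 2)
        + 2 * (((z.re - 1) * (c * ρ * (X s).re - (F s).re)
            - z.im * (c * ρ * (X s).im - (F s).im)) * (X s).re
          + ((z.re - 1) * (c * ρ * (X s).im - (F s).im)
            + z.im * (c * ρ * (X s).re - (F s).re)) * (X s).im)))) s := by
    intro s
    have h1 := (hXd s).complex_re_part
    have h2 := (hXd s).complex_im_part
    have h3 := (hFd s).complex_re_part
    have h4 := (hFd s).complex_im_part
    have h := (((h1.mul h4).sub (h2.mul h3)).const_mul ((z.re - 1) ^ 2 + z.im ^ 2)).sub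
      (((hE s).mul ((h1.pow 2).add (h2.pow 2))).const_mul z.im)
    refine HasDerivAt.congr_deriv h ?_
    simp [pow_two]
    ring
  have hmono : MonotoneOn Ψ (Set.Icc 0 s) := by
    refine monotoneOn_of_deriv_nonneg (convex_Icc 0 s)
      (fun r _ => (hΨd r).continuousAt.continuousWithinAt)
      (fun r _ => (hΨd r).differentiableAt.differentiableWithinAt) fun r hr => ?_
    rw [interior_Icc] at hr
    rw [(hΨd r).deriv]
    refine lyapunov_deriv_nonneg hρ hz.le (Real.exp_nonneg _) ?_
    rw [Real.exp_le_one_iff]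
    nlinarith [hr.1]
  have h0 : Ψ 0 = 0 := by
    simp [hΨ, hX, hF, flowX_zero, flowF_zero]
  have hs' : 0 ≤ Ψ s := h0 ▸ hmono ⟨le_rfl, hs⟩ ⟨hs, le_rfl⟩ hs
  have hn : ∀ w : ℂ, ‖w‖ ^ 2 = w.re ^ 2 + w.im ^ 2 := fun w => by
    rw [Complex.sq_norm, Complex.normSq_apply]; ring
  have hD : (X s).re * (F s).im - (X s).im * (F s).re ≤ ‖X s‖ * ‖F s‖ := by
    have := Complex.abs_im_le_norm (starRingEnd ℂ (X s) * F s)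
    rw [norm_mul, Complex.norm_conj] at this
    refine le_trans (le_trans (le_of_eq ?_) (le_abs_self _)) this
    simp
    ring
  have h5 : ‖z - 1‖ ^ 2 = (z.re - 1) ^ 2 + z.im ^ 2 := by rw [hn]; simp
  have h6 := mul_le_mul_of_nonneg_left hD (sq_nonneg ‖z - 1‖)
  refine le_trans ?_ h6
  rw [h5, hn (X s)]
  linarith [hs']

/-- A zero of F would force X = 0 through the Lyapunov bound, and F and S have no common zero. -/
theorem flowF_ne_zero_of_im_pos {a c ρ : ℝ} (hρ : ρ ∈ Set.Icc (-1 : ℝ) 1) {z : ℂ}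
    (hz : 0 < z.im) {s : ℝ} (hs : 0 ≤ s) : flowF a c ρ z s ≠ 0 := by
  intro h
  have h1 := exp_mul_normSq_flowX_le (a := a) (c := c) hρ hz hs
  rw [h, norm_zero, mul_zero, mul_zero] at h1
  have hX : flowX a c ρ z s = 0 := by
    by_contra hne
    have : 0 < ‖flowX a c ρ z s‖ := norm_pos_iff.2 hne
    have h2 : 0 < z.im * (Real.exp (-(2 * |c * ρ - a| + 1) * s) * ‖flowX a c ρ z s‖ ^ 2) := by
      positivity
    linarith
  rw [flowX, mul_eq_zero] at hX
  rcases hX with hX | hX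
  · have : z = 1 := by linear_combination -hX
    simp [this] at hz
  · exact flowF_ne_zero_of_flowS_eq_zero hX h

theorem flowF_ne_zero_of_im_ne_zero {a c ρ : ℝ} (hρ : ρ ∈ Set.Icc (-1 : ℝ) 1) {z : ℂ}
    (hz : z.im ≠ 0) {s : ℝ} (hs : 0 ≤ s) : flowF a c ρ z s ≠ 0 := by
  rcases lt_or_gt_of_ne hz with h | h
  · have := flowF_ne_zero_of_im_pos (a := a) (c := c) hρ
      (z := starRingEnd ℂ z) (by simpa using h) hs
    rw [flowF_conj] at this
    simpa using this
  · exact flowF_ne_zero_of_im_pos hρ h hs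

theorem norm_flow_div_le_of_im_pos {a c ρ : ℝ} (hρ : ρ ∈ Set.Icc (-1 : ℝ) 1) {z : ℂ}
    (hz : 0 < z.im) {s : ℝ} (hs : 0 ≤ s) :
    ‖flowX a c ρ z s / flowF a c ρ z s‖ ≤
      Real.exp ((2 * |c * ρ - a| + 1) * s) * ‖z - 1‖ ^ 2 / |z.im| := by
  have h := exp_mul_normSq_flowX_le (a := a) (c := c) hρ hz hs
  have hF : 0 < ‖flowF a c ρ z s‖ := norm_pos_iff.2 (flowF_ne_zero_of_im_pos hρ hz hs)
  rw [abs_of_pos hz, norm_div, div_le_div_iff₀ hF hz]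
  rcases (norm_nonneg (flowX a c ρ z s)).eq_or_lt with h0 | h0
  · rw [← h0, zero_mul]
    positivity
  have h1 : z.im * (Real.exp (-(2 * |c * ρ - a| + 1) * s) * ‖flowX a c ρ z s‖) ≤
      ‖z - 1‖ ^ 2 * ‖flowF a c ρ z s‖ := by
    refine le_of_mul_le_mul_right ?_ h0
    linarith
  have h2 : Real.exp ((2 * |c * ρ - a| + 1) * s) * Real.exp (-(2 * |c * ρ - a| + 1) * s) = 1 := by
    rw [← Real.exp_add, neg_mul, add_neg_cancel, Real.exp_zero]
  have h3 := mul_le_mul_of_nonneg_left h1 (Real.exp_nonneg ((2 * |c * ρ - a| + 1) * s))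
  linear_combination h3 - z.im * ‖flowX a c ρ z s‖ * h2

theorem norm_flow_div_le {a c ρ : ℝ} (hρ : ρ ∈ Set.Icc (-1 : ℝ) 1) {z : ℂ}
    (hz : z.im ≠ 0) {s : ℝ} (hs : 0 ≤ s) :
    ‖flowX a c ρ z s / flowF a c ρ z s‖ ≤
      Real.exp ((2 * |c * ρ - a| + 1) * s) * ‖z - 1‖ ^ 2 / |z.im| := by
  rcases lt_or_gt_of_ne hz with h | h
  · have := norm_flow_div_le_of_im_pos (a := a) (c := c) hρ
      (z := starRingEnd ℂ z) (by simpa using h) hs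
    have h2 : starRingEnd ℂ z - 1 = starRingEnd ℂ (z - 1) := by simp
    rw [flowF_conj, flowX_conj, ← map_div₀, Complex.norm_conj, h2, Complex.norm_conj,
      Complex.conj_im, abs_neg] at this
    exact this
  · exact norm_flow_div_le_of_im_pos hρ h hs

end Heston

/-! ### Bessel's inequality for pairs of functions -/

theorem bessel_inequality_intervalIntegral {ι : Type*} {T : ℝ} (hT : 0 ≤ T) {A B : ι → ℝ → ℝ}
    (hA : ∀ i, Continuous (A i)) (hB : ∀ i, Continuous (B i))
    (horth : ∀ i j, i ≠ j → ∫ s in (0)..T, (A i s * A j s + B i s * B j s) = 0)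
    (hpos : ∀ i, 0 < ∫ s in (0)..T, (A i s * A i s + B i s * B i s)) (t : Finset ι) :
    ∀ {A₀ B₀ : ℝ → ℝ}, Continuous A₀ → Continuous B₀ →
      ∑ i ∈ t, (∫ s in (0)..T, (A₀ s * A i s + B₀ s * B i s)) ^ 2 /
          (∫ s in (0)..T, (A i s * A i s + B i s * B i s)) ≤
        ∫ s in (0)..T, (A₀ s * A₀ s + B₀ s * B₀ s) := by
  classical
  induction t using Finset.induction_on with
  | empty =>
    intro A₀ B₀ _ _
    rw [Finset.sum_empty]
    exact intervalIntegral.integral_nonneg hT fun s _ =>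
      add_nonneg (mul_self_nonneg _) (mul_self_nonneg _)
  | insert i t hi ih =>
    intro A₀ B₀ hA₀ hB₀
    -- Subtract the projection on the i-th pair. By orthogonality the remainder has the same
    -- products with the other pairs, and its square norm is smaller by J²/N. The induction
    -- hypothesis is used for this remainder, hence the quantifier over `A₀` and `B₀` in the
    -- conclusion.
    set N := ∫ s in (0)..T, (A i s * A i s + B i s * B i s) with hN
    set J := ∫ s in (0)..T, (A₀ s * A i s + B₀ s * B i s) with hJ
    have hNpos : 0 < N := hpos i
    set k := J / N with hk
    have hAi := hA i
    have hBi := hB i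
    have h := ih (A₀ := fun s => A₀ s - k * A i s) (B₀ := fun s => B₀ s - k * B i s)
      (by fun_prop) (by fun_prop)
    have h1 : ∀ j ∈ t, ∫ s in (0)..T, ((A₀ s - k * A i s) * A j s + (B₀ s - k * B i s) * B j s)
        = ∫ s in (0)..T, (A₀ s * A j s + B₀ s * B j s) := by
      intro j hj
      have hAj := hA j
      have hBj := hB j
      have hij : i ≠ j := fun h => hi (h ▸ hj)
      have : ∀ s, (A₀ s - k * A i s) * A j s + (B₀ s - k * B i s) * B j s
          = (A₀ s * A j s + B₀ s * B j s) - k * (A i s * A j s + B i s * B j s) :=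
        fun s => by ring
      simp only [this]
      rw [intervalIntegral.integral_sub, intervalIntegral.integral_const_mul, horth i j hij,
        mul_zero, sub_zero]
      · exact Continuous.intervalIntegrable (by fun_prop) _ _
      · exact Continuous.intervalIntegrable (by fun_prop) _ _
    have h2 : ∫ s in (0)..T, ((A₀ s - k * A i s) * (A₀ s - k * A i s)
        + (B₀ s - k * B i s) * (B₀ s - k * B i s))
        = (∫ s in (0)..T, (A₀ s * A₀ s + B₀ s * B₀ s)) - 2 * k * J + k ^ 2 * N := by
      have : ∀ s, (A₀ s - k * A i s) * (A₀ s - k * A i s)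
          + (B₀ s - k * B i s) * (B₀ s - k * B i s)
          = ((A₀ s * A₀ s + B₀ s * B₀ s) - 2 * k * (A₀ s * A i s + B₀ s * B i s))
            + k ^ 2 * (A i s * A i s + B i s * B i s) :=
        fun s => by ring
      simp only [this]
      rw [intervalIntegral.integral_add, intervalIntegral.integral_sub,
        intervalIntegral.integral_const_mul, intervalIntegral.integral_const_mul]
      all_goals exact Continuous.intervalIntegrable (by fun_prop) _ _
    rw [h2, Finset.sum_congr rfl fun j hj => by rw [h1 j hj]] at h
    rw [Finset.sum_insert hi]
    have h3 : 2 * k * J - k ^ 2 * N = J ^ 2 / N := by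
      rw [hk]; field_simp; ring
    linarith

/-! ### Lagrange identity, energy and residues -/

/-- Continuity of g suffices, so the Lagrange identity can be differentiated in w without
differentiating under the integral. -/
theorem hasDerivAt_sub_mul_of_continuousAt {g : ℂ → ℂ} {x : ℂ} (hg : ContinuousAt g x) :
    HasDerivAt (fun w => (w - x) * g w) (g x) x := by
  rw [hasDerivAt_iff_tendsto_slope]
  refine (hg.tendsto.mono_left nhdsWithin_le_nhds).congr' ?_
  filter_upwards [self_mem_nhdsWithin] with w hw
  have : w - x ≠ 0 := sub_ne_zero.2 hw
  rw [slope_def_field]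
  field_simp
  ring

namespace Heston

/-- The bilinear form of the Hamiltonian `[[c², -cρ], [-cρ, 1]]` along two solutions. -/
noncomputable def formC (a c ρ : ℝ) (z w : ℂ) (s : ℝ) : ℂ :=
  c ^ 2 * (flowX a c ρ z s * flowX a c ρ w s)
    - c * ρ * (flowX a c ρ z s * flowF a c ρ w s + flowF a c ρ z s * flowX a c ρ w s)
    + flowF a c ρ z s * flowF a c ρ w s

theorem continuous_formC_time (a c ρ : ℝ) (z w : ℂ) : Continuous (formC a c ρ z w) := by
  have h1 := continuous_flowX_time a c ρ z
  have h2 := continuous_flowX_time a c ρ w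
  have h3 := continuous_flowF_time a c ρ z
  have h4 := continuous_flowF_time a c ρ w
  unfold formC
  fun_prop

/-- Lagrange identity of the canonical system. -/
theorem sub_mul_integral_formC (a c ρ : ℝ) (z w : ℂ) (T : ℝ) :
    (w - z) * ∫ s in (0)..T, formC a c ρ z w s =
      flowX a c ρ z T * flowF a c ρ w T - flowF a c ρ z T * flowX a c ρ w T := by
  have hd : ∀ s, HasDerivAt
      (fun s => flowX a c ρ z s * flowF a c ρ w s - flowF a c ρ z s * flowX a c ρ w s)
      ((w - z) * formC a c ρ z w s) s := by
    intro s
    have h := ((hasDerivAt_flowX a c ρ z s).mul (hasDerivAt_flowF a c ρ w s)).sub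
      ((hasDerivAt_flowF a c ρ z s).mul (hasDerivAt_flowX a c ρ w s))
    refine HasDerivAt.congr_deriv h ?_
    rw [formC]
    ring
  rw [← intervalIntegral.integral_const_mul,
    intervalIntegral.integral_eq_sub_of_hasDerivAt (fun s _ => hd s)
      (Continuous.intervalIntegrable (continuous_const.mul (continuous_formC_time a c ρ z w)) _ _)]
  simp [flowX_zero, flowF_zero]

theorem continuous_integral_formC (a c ρ : ℝ) (z : ℂ) (T : ℝ) :
    Continuous fun w => ∫ s in (0)..T, formC a c ρ z w s := by
  refine intervalIntegral.continuous_parametric_intervalIntegral_of_continuous' ?_ 0 T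
  have h1 := (continuous_flowX_time a c ρ z).comp (continuous_snd (X := ℂ))
  have h2 := continuous_flowX a c ρ
  have h3 := (continuous_flowF_time a c ρ z).comp (continuous_snd (X := ℂ))
  have h4 := continuous_flowF a c ρ
  exact ((continuous_const.mul (h1.mul h2)).sub
    (continuous_const.mul ((h1.mul h4).add (h3.mul h2)))).add (h3.mul h4)

/-- At a zero x of F the Lagrange identity reads X(x)F(w) = (w - x)∫ form(x, w); take the derivative
at w = x. -/
theorem flowX_mul_deriv_flowF (a c ρ : ℝ) {x : ℂ} {T : ℝ} (hx : flowF a c ρ x T = 0) :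
    flowX a c ρ x T * deriv (fun z => flowF a c ρ z T) x = ∫ s in (0)..T, formC a c ρ x x s := by
  have h := hasDerivAt_sub_mul_of_continuousAt (continuous_integral_formC a c ρ x T).continuousAt
    (x := x)
  have h2 : (fun w => (w - x) * ∫ s in (0)..T, formC a c ρ x w s) =
      fun w => flowX a c ρ x T * flowF a c ρ w T := by
    ext w
    rw [sub_mul_integral_formC, hx, zero_mul, sub_zero]
  rw [h2] at h
  rw [← h.deriv, deriv_const_mul _ (differentiable_flowF a c ρ T x)]

/-- First coordinate of the diagonalised Hamiltonian form along the solution at real `x`. -/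
noncomputable def coordA (a c ρ x s : ℝ) : ℝ := c * √(1 - ρ ^ 2) * (flowX a c ρ x s).re

/-- Second coordinate of the diagonalised Hamiltonian form along the solution at real `x`. -/
noncomputable def coordB (a c ρ x s : ℝ) : ℝ :=
  c * ρ * (flowX a c ρ x s).re - (flowF a c ρ x s).re

theorem continuous_coordA (a c ρ x : ℝ) : Continuous (coordA a c ρ x) :=
  continuous_const.mul (Complex.continuous_re.comp (continuous_flowX_time a c ρ x))

theorem continuous_coordB (a c ρ x : ℝ) : Continuous (coordB a c ρ x) :=
  (continuous_const.mul (Complex.continuous_re.comp (continuous_flowX_time a c ρ x))).sub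
    (Complex.continuous_re.comp (continuous_flowF_time a c ρ x))

theorem ofReal_re_flowX (a c ρ x s : ℝ) : ((flowX a c ρ x s).re : ℂ) = flowX a c ρ x s :=
  Complex.ext rfl (flowX_ofReal_im a c ρ x s).symm

theorem ofReal_re_flowF (a c ρ x s : ℝ) : ((flowF a c ρ x s).re : ℂ) = flowF a c ρ x s :=
  Complex.ext rfl (flowF_ofReal_im a c ρ x s).symm

theorem formC_ofReal {a c ρ : ℝ} (hρ : ρ ∈ Set.Icc (-1 : ℝ) 1) (x y s : ℝ) :
    formC a c ρ x y s =
      ((coordA a c ρ x s * coordA a c ρ y s + coordB a c ρ x s * coordB a c ρ y s : ℝ) : ℂ) := by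
  have h1 : 0 ≤ 1 - ρ ^ 2 := by nlinarith [hρ.1, hρ.2]
  have h2 : √(1 - ρ ^ 2) * √(1 - ρ ^ 2) = 1 - ρ ^ 2 := Real.mul_self_sqrt h1
  have h3 : coordA a c ρ x s * coordA a c ρ y s + coordB a c ρ x s * coordB a c ρ y s =
      c ^ 2 * ((flowX a c ρ x s).re * (flowX a c ρ y s).re)
      - c * ρ * ((flowX a c ρ x s).re * (flowF a c ρ y s).re
        + (flowF a c ρ x s).re * (flowX a c ρ y s).re)
      + (flowF a c ρ x s).re * (flowF a c ρ y s).re := by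
    rw [coordA, coordA, coordB, coordB]
    linear_combination c ^ 2 * (flowX a c ρ x s).re * (flowX a c ρ y s).re * h2
  rw [h3, formC]
  push_cast
  simp only [ofReal_re_flowX, ofReal_re_flowF]

/-- The energy inner product of the solutions at two real spectral parameters. -/
noncomputable def energy (a c ρ T x y : ℝ) : ℝ :=
  ∫ s in (0)..T, (coordA a c ρ x s * coordA a c ρ y s + coordB a c ρ x s * coordB a c ρ y s)

theorem integral_formC_ofReal {a c ρ : ℝ} (hρ : ρ ∈ Set.Icc (-1 : ℝ) 1) (T x y : ℝ) :
    ∫ s in (0)..T, formC a c ρ x y s = (energy a c ρ T x y : ℂ) := by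
  simp only [formC_ofReal hρ]
  rw [intervalIntegral.integral_ofReal, energy]

theorem energy_self_pos (a c ρ x : ℝ) {T : ℝ} (hT : 0 < T) : 0 < energy a c ρ T x x := by
  have hA := continuous_coordA a c ρ x
  have hB := continuous_coordB a c ρ x
  refine intervalIntegral.integral_pos hT (Continuous.continuousOn (by fun_prop))
    (fun s _ => add_nonneg (mul_self_nonneg _) (mul_self_nonneg _)) ⟨0, ⟨le_rfl, hT.le⟩, ?_⟩
  -- At s = 0 the second coordinate is -1, so the integrand is positive there.
  simp [coordA, coordB, flowX_zero, flowF_zero]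

theorem sub_mul_energy {a c ρ : ℝ} (hρ : ρ ∈ Set.Icc (-1 : ℝ) 1) (T x y : ℝ) :
    (y - x) * energy a c ρ T x y =
      (flowX a c ρ x T).re * (flowF a c ρ y T).re
        - (flowF a c ρ x T).re * (flowX a c ρ y T).re := by
  have h := sub_mul_integral_formC a c ρ x y T
  rw [integral_formC_ofReal hρ] at h
  apply Complex.ofReal_injective
  push_cast
  simpa only [ofReal_re_flowX, ofReal_re_flowF] using h

/-- The residue of `G` at the real zero `x` of `F`. -/
noncomputable def residue (a c ρ T x : ℝ) : ℝ :=
  (flowX a c ρ x T).re ^ 2 / energy a c ρ T x x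

theorem flowX_mul_deriv_flowF_eq_energy {a c ρ : ℝ} (hρ : ρ ∈ Set.Icc (-1 : ℝ) 1) {T x : ℝ}
    (hx : flowF a c ρ x T = 0) :
    flowX a c ρ x T * deriv (fun z => flowF a c ρ z T) x = (energy a c ρ T x x : ℂ) := by
  rw [flowX_mul_deriv_flowF a c ρ hx, integral_formC_ofReal hρ]

theorem flowX_and_deriv_ne_zero {a c ρ : ℝ} (hρ : ρ ∈ Set.Icc (-1 : ℝ) 1) {T x : ℝ} (hT : 0 < T)
    (hx : flowF a c ρ x T = 0) :
    flowX a c ρ x T ≠ 0 ∧ deriv (fun z => flowF a c ρ z T) x ≠ 0 := by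
  rw [← mul_ne_zero_iff, flowX_mul_deriv_flowF_eq_energy hρ hx]
  exact_mod_cast (energy_self_pos a c ρ x hT).ne'

theorem residue_pos {a c ρ : ℝ} (hρ : ρ ∈ Set.Icc (-1 : ℝ) 1) {T x : ℝ} (hT : 0 < T)
    (hx : flowF a c ρ x T = 0) : 0 < residue a c ρ T x := by
  have h := (flowX_and_deriv_ne_zero hρ hT hx).1
  rw [← ofReal_re_flowX] at h
  have h2 : (flowX a c ρ x T).re ≠ 0 := by exact_mod_cast h
  exact div_pos (by positivity) (energy_self_pos a c ρ x hT)

theorem ofReal_residue {a c ρ : ℝ} (hρ : ρ ∈ Set.Icc (-1 : ℝ) 1) {T x : ℝ} (hT : 0 < T)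
    (hx : flowF a c ρ x T = 0) :
    (residue a c ρ T x : ℂ) = flowX a c ρ x T / deriv (fun z => flowF a c ρ z T) x := by
  have h := flowX_and_deriv_ne_zero hρ hT hx
  rw [residue, Complex.ofReal_div, ← flowX_mul_deriv_flowF_eq_energy hρ hx, Complex.ofReal_pow,
    ofReal_re_flowX]
  field_simp [h.1, h.2]

/-- The Lagrange identity between 0 and a zero x gives the product -F(0)X(x)/x, so the Bessel terms
of the solution at 0 are F(0)² b/x². Between two zeros its right side vanishes, which is the
orthogonality. -/
theorem sum_residue_div_sq_le {a c ρ : ℝ} (hρ : ρ ∈ Set.Icc (-1 : ℝ) 1) {T : ℝ} (hT : 0 < T)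
    (h0 : flowF a c ρ 0 T ≠ 0) {ι : Type*} {x : ι → ℝ} (hinj : Function.Injective x)
    (hx : ∀ i, flowF a c ρ (x i) T = 0) (t : Finset ι) :
    ∑ i ∈ t, residue a c ρ T (x i) / x i ^ 2 ≤
      energy a c ρ T 0 0 / (flowF a c ρ (0 : ℝ) T).re ^ 2 := by
  have hre : ∀ i, (flowF a c ρ (x i) T).re = 0 := fun i => by rw [hx i]; rfl
  have h0' : (flowF a c ρ (0 : ℝ) T).re ≠ 0 := by
    intro h
    apply h0
    have := ofReal_re_flowF a c ρ 0 T
    rw [h] at this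
    simpa using this.symm
  have hxi : ∀ i, x i ≠ 0 := by
    intro i h
    have := hre i
    rw [h] at this
    exact h0' this
  have hb := bessel_inequality_intervalIntegral hT.le (A := fun i => coordA a c ρ (x i))
    (B := fun i => coordB a c ρ (x i)) (fun i => continuous_coordA _ _ _ _)
    (fun i => continuous_coordB _ _ _ _) ?_ (fun i => energy_self_pos a c ρ (x i) hT) t
    (continuous_coordA a c ρ 0) (continuous_coordB a c ρ 0)
  · rw [le_div_iff₀ (by positivity), Finset.sum_mul]
    refine le_trans (le_of_eq (Finset.sum_congr rfl fun i _ => ?_)) hb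
    have h1 := sub_mul_energy hρ T 0 (x i) (a := a) (c := c)
    have h2 := energy_self_pos a c ρ (x i) hT
    have h3 := hxi i
    change _ = energy a c ρ T 0 (x i) ^ 2 / energy a c ρ T (x i) (x i)
    rw [hre i, mul_zero, zero_sub, sub_zero] at h1
    have h4 : energy a c ρ T 0 (x i) =
        -((flowF a c ρ (0 : ℝ) T).re * (flowX a c ρ (x i) T).re) / x i := by
      rw [eq_div_iff h3, ← h1]; ring
    rw [h4, residue]
    field_simp
  · intro i j hij
    have h1 := sub_mul_energy hρ T (x i) (x j) (a := a) (c := c)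
    rw [hre i, hre j, mul_zero, zero_mul, sub_zero, mul_eq_zero] at h1
    refine h1.resolve_left fun h => hij (hinj ?_)
    linarith

end Heston

/-! ### Infinitely many zeros and their enumeration -/

/-- An infinite set meeting every ball in a finite set can be listed, without repetition, by
nondecreasing norm. -/
theorem exists_monotone_enumeration {A : Set ℂ} (hA : A.Infinite)
    (hfin : ∀ R : ℝ, (A ∩ Metric.closedBall 0 R).Finite) :
    ∃ α : ℕ → ℂ, Function.Injective α ∧ Set.range α = A ∧ Monotone fun n => ‖α n‖ := by
  classical
  -- a minimal-norm element of what is left after removing a finite set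
  have hmin : ∀ s : Finset ℂ, ∃ x ∈ A, x ∉ s ∧ ∀ y ∈ A, y ∉ s → ‖x‖ ≤ ‖y‖ := by
    intro s
    obtain ⟨x₀, hx₀, hx₀s⟩ := hA.exists_notMem_finset s
    have hf : ((A ∩ Metric.closedBall 0 ‖x₀‖) \ s).Finite := (hfin ‖x₀‖).subset Set.sdiff_subset
    obtain ⟨x, hx, hxmin⟩ := hf.exists_minimalFor (fun x => ‖x‖) _
      ⟨x₀, ⟨hx₀, by simp⟩, hx₀s⟩
    refine ⟨x, hx.1.1, hx.2, fun y hy hys => ?_⟩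
    by_contra! hlt
    have hyball : y ∈ (A ∩ Metric.closedBall 0 ‖x₀‖) \ (s : Set ℂ) := by
      refine ⟨⟨hy, ?_⟩, hys⟩
      have h1 : ‖x‖ ≤ ‖x₀‖ := by simpa using hx.1.2
      simpa using hlt.le.trans h1
    exact absurd (hxmin hyball hlt.le) (not_le.2 hlt)
  choose f hfA hfs hfmin using hmin
  let S : ℕ → Finset ℂ := fun n => Nat.rec ∅ (fun _ s => insert (f s) s) n
  have hS : ∀ n, S (n + 1) = insert (f (S n)) (S n) := fun n => rfl
  have hSmono : Monotone S := monotone_nat_of_le_succ fun n => by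
    rw [hS]; exact Finset.subset_insert _ _
  have hmem : ∀ m n, m < n → f (S m) ∈ S n := fun m n hmn =>
    hSmono (Nat.succ_le_of_lt hmn) (by rw [hS]; exact Finset.mem_insert_self _ _)
  have hinj : Function.Injective fun n => f (S n) := by
    intro m n hmn
    rcases lt_trichotomy m n with h | h | h
    · exact absurd ((show f (S m) = f (S n) from hmn) ▸ hmem m n h) (hfs (S n))
    · exact h
    · exact absurd ((show f (S m) = f (S n) from hmn).symm ▸ hmem n m h) (hfs (S m))
  refine ⟨fun n => f (S n), hinj, ?_, ?_⟩
  · refine Set.Subset.antisymm (Set.range_subset_iff.2 fun n => hfA _) fun x hx => ?_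
    by_contra hxr
    have hxS : ∀ n, x ∉ S n := by
      intro n
      induction n with
      | zero => exact Finset.notMem_empty x
      | succ n ih =>
        rw [hS, Finset.mem_insert, not_or]
        exact ⟨fun h => hxr ⟨n, h.symm⟩, ih⟩
    -- A missed point x stays available at every stage, so all chosen points have norm at most ‖x‖,
    -- contradicting finiteness in that ball.
    refine (Set.infinite_range_of_injective hinj) ((hfin ‖x‖).subset ?_)
    rintro _ ⟨n, rfl⟩
    exact ⟨hfA _, by simpa using hfmin (S n) x hx (hxS n)⟩
  · refine monotone_nat_of_le_succ fun n => hfmin _ _ (hfA _) fun h => ?_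
    exact hfs (S (n + 1)) (hSmono (Nat.le_succ n) h)

namespace Heston

theorem flowF_at_zero (a c ρ T : ℝ) :
    flowF a c ρ 0 T = Complex.exp (a * T) := by
  have h1 : p a c ρ 0 * (T : ℂ) ^ 2 = ((a : ℂ) * T) ^ 2 := by simp [p]; ring
  have h2 : (a : ℂ) * flowS a c ρ 0 T = Complex.sinh (a * T) := by
    rw [flowS, h1, ← mul_sinhcSqrt_sq]
    ring
  rw [flowF, mul_zero, sub_zero, h2, h1, coshSqrt_sq, Complex.cosh_add_sinh]

theorem flowX_at_zero {a c ρ : ℝ} (ha : a ≠ 0) (T : ℝ) :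
    flowX a c ρ 0 T = Complex.sinh (a * T) / a := by
  have h1 : p a c ρ 0 * (T : ℂ) ^ 2 = ((a : ℂ) * T) ^ 2 := by simp [p]; ring
  have ha' : (a : ℂ) ≠ 0 := by exact_mod_cast ha
  rw [flowX, eq_div_iff ha', ← mul_sinhcSqrt_sq, flowS, h1]
  ring

theorem flowF_zero_ne_zero (a c ρ T : ℝ) : flowF a c ρ 0 T ≠ 0 := by
  rw [flowF_at_zero]
  exact Complex.exp_ne_zero _

/-- Accumulating zeros would make F vanish identically, but F(0) = exp(aT). -/
theorem finite_zeros_closedBall (a c ρ T R : ℝ) :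
    ({z : ℂ | flowF a c ρ z T = 0} ∩ Metric.closedBall 0 R).Finite := by
  by_contra hinf
  obtain ⟨x, -, hacc⟩ := Set.Infinite.exists_accPt_of_subset_isCompact hinf
    (isCompact_closedBall (0 : ℂ) R) Set.inter_subset_right
  have han : AnalyticOnNhd ℂ (fun z => flowF a c ρ z T) Set.univ :=
    (differentiable_flowF a c ρ T).differentiableOn.analyticOnNhd isOpen_univ
  have hfr : ∃ᶠ z in 𝓝[≠] x, flowF a c ρ z T = 0 :=
    (accPt_iff_frequently_nhdsNE.1 hacc).mono fun z hz => hz.1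
  have h := han.eqOn_zero_of_preconnected_of_frequently_eq_zero isPreconnected_univ
    (Set.mem_univ x) hfr
  exact flowF_zero_ne_zero a c ρ T (h (Set.mem_univ 0))

/-- The polynomial `p` at a real argument. -/
theorem p_ofReal (a c ρ x : ℝ) :
    p a c ρ x = ((a ^ 2 + c * (c - 2 * a * ρ) * x - (1 - ρ ^ 2) * c ^ 2 * x ^ 2 : ℝ) : ℂ) := by
  rw [p]
  push_cast
  ring

/-- Here PT = kπi, so the sinh term drops out and cos kπ remains. For k = 0 the quotient sinh(w)/w
is 1 and this fails. -/
theorem flowF_of_p_eq {a c ρ x T : ℝ} {k : ℕ} (hk : k ≠ 0) (hT : T ≠ 0)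
    (h : a ^ 2 + c * (c - 2 * a * ρ) * x - (1 - ρ ^ 2) * c ^ 2 * x ^ 2 =
      -((k * Real.pi) ^ 2 / T ^ 2)) :
    flowF a c ρ x T = (-1) ^ k := by
  have h1 : p a c ρ x * (T : ℂ) ^ 2 = ((k * Real.pi : ℂ) * Complex.I) ^ 2 := by
    have hT' : (T : ℂ) ≠ 0 := by exact_mod_cast hT
    rw [p_ofReal, h, mul_pow _ Complex.I, Complex.I_sq]
    push_cast
    field_simp
  have h2 : sinhcSqrt (((k * Real.pi : ℂ) * Complex.I) ^ 2) = 0 := by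
    have h3 := mul_sinhcSqrt_sq ((k * Real.pi : ℂ) * Complex.I)
    rw [Complex.sinh_mul_I, Complex.sin_nat_mul_pi, zero_mul, mul_eq_zero] at h3
    refine h3.resolve_left ?_
    simp [hk, Real.pi_ne_zero]
  have h4 : Complex.cos (k * Real.pi) = (-1) ^ k := by
    exact_mod_cast congrArg Complex.ofReal (Real.cos_nat_mul_pi k)
  rw [flowF, flowS, h1, h2, coshSqrt_sq, Complex.cosh_mul_I, h4]
  simp

/-- Take σ opposite in sign to the linear coefficient m of p, and μ = |m| + κ with -κ the quadratic
coefficient; x ≤ x² for x ≥ 1 does the rest. Both m and κ vanish only when ρ = 1 and c = 2a, since ρ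
= -1 leaves c + 2a > 0. -/
theorem exists_sign_p_le {a c ρ : ℝ} (hc : 0 < c) (hρ : ρ ∈ Set.Icc (-1 : ℝ) 1) (ha : 0 < a)
    (hdeg : ¬ (ρ = 1 ∧ c = 2 * a)) :
    ∃ σ : ℝ, |σ| = 1 ∧ ∃ μ : ℝ, 0 < μ ∧ ∀ x : ℝ, 1 ≤ x →
      a ^ 2 + c * (c - 2 * a * ρ) * (σ * x) - (1 - ρ ^ 2) * c ^ 2 * (σ * x) ^ 2 ≤
        a ^ 2 - μ * x := by
  set m := c * (c - 2 * a * ρ) with hm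
  set κ := (1 - ρ ^ 2) * c ^ 2 with hκ
  have hκ0 : 0 ≤ κ := mul_nonneg (by nlinarith [hρ.1, hρ.2]) (sq_nonneg c)
  have hpos : 0 < |m| + κ := by
    rcases hκ0.eq_or_lt with h | h
    · have h1 : (1 - ρ) * (1 + ρ) = 0 := by
        have : (1 - ρ ^ 2) = 0 := by
          rcases mul_eq_zero.1 h.symm with h | h
          · exact h
          · exact absurd h (by positivity)
        linarith
      have hm0 : m ≠ 0 := by
        rw [hm]
        refine mul_ne_zero hc.ne' fun h2 => ?_
        rcases mul_eq_zero.1 h1 with h3 | h3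
        · have : ρ = 1 := by linarith
          exact hdeg ⟨this, by rw [this] at h2; linarith⟩
        · have : ρ = -1 := by linarith
          rw [this] at h2
          linarith
      have := abs_pos.2 hm0
      linarith
    · have := abs_nonneg m
      linarith
  obtain ⟨σ, hσ, hσm⟩ : ∃ σ : ℝ, |σ| = 1 ∧ m * σ = -|m| := by
    rcases le_total 0 m with h | h
    · exact ⟨-1, by simp, by rw [abs_of_nonneg h]; ring⟩
    · exact ⟨1, by simp, by rw [abs_of_nonpos h]; ring⟩
  refine ⟨σ, hσ, |m| + κ, hpos, fun x hx => ?_⟩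
  have hσ2 : σ ^ 2 = 1 := by rw [← sq_abs, hσ, one_pow]
  have h3 : κ * x ≤ κ * x ^ 2 := mul_le_mul_of_nonneg_left (by nlinarith) hκ0
  rw [mul_pow, hσ2, one_mul, ← mul_assoc, hσm]
  linarith

theorem exists_zero_norm_gt {a c ρ : ℝ} (ha : 0 < a) (hc : 0 < c) (hρ : ρ ∈ Set.Icc (-1 : ℝ) 1)
    (hdeg : ¬ (ρ = 1 ∧ c = 2 * a)) {T : ℝ} (hT : 0 < T) (R : ℝ) :
    ∃ z : ℂ, flowF a c ρ z T = 0 ∧ R ≤ ‖z‖ := by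
  obtain ⟨σ, hσ, μ, hμ, hle⟩ := exists_sign_p_le hc hρ ha hdeg
  set q : ℝ → ℝ := fun x =>
    a ^ 2 + c * (c - 2 * a * ρ) * (σ * x) - (1 - ρ ^ 2) * c ^ 2 * (σ * x) ^ 2 with hq
  have hqc : Continuous q := by fun_prop
  set R' := max R 1 with hR'
  have hex : ∀ k : ℕ, k ≠ 0 → -((k * Real.pi) ^ 2 / T ^ 2) ≤ q R' →
      ∃ x : ℝ, R' ≤ x ∧ flowF a c ρ ((σ * x : ℝ) : ℂ) T = (-1) ^ k := by
    intro k hk hkR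
    set y := -((k * Real.pi) ^ 2 / T ^ 2) with hy
    set x₁ := max R' ((a ^ 2 - y) / μ) with hx₁
    have h1 : q x₁ ≤ y := by
      refine (hle x₁ ((le_max_right R 1).trans (le_max_left _ _))).trans ?_
      have := le_max_right R' ((a ^ 2 - y) / μ)
      rw [div_le_iff₀ hμ] at this
      linarith
    obtain ⟨x, hx, hxy⟩ := intermediate_value_Icc' (le_max_left R' ((a ^ 2 - y) / μ))
      hqc.continuousOn ⟨h1, hkR⟩
    exact ⟨x, hx.1, flowF_of_p_eq hk hT.ne' hxy⟩
  -- For j ≥ k the level -(jπ/T)² lies below p at the start of the half-line, so p crosses it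
  -- further out.
  obtain ⟨k, hk⟩ := exists_nat_ge ((1 + |q R'|) * T ^ 2)
  have hkey : ∀ j : ℕ, j ≠ 0 → k ≤ j → -((j * Real.pi) ^ 2 / T ^ 2) ≤ q R' := by
    intro j hj0 hj
    have h1 : (1 : ℝ) ≤ j := by exact_mod_cast Nat.one_le_iff_ne_zero.2 hj0
    have h2 : (k : ℝ) ≤ j := by exact_mod_cast hj
    have h3 : |q R'| ≤ (j * Real.pi) ^ 2 / T ^ 2 := by
      rw [le_div_iff₀ (by positivity)]
      have h4 : (j : ℝ) ≤ (j * Real.pi) ^ 2 := by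
        have h5 : (j : ℝ) ≤ j * Real.pi := by nlinarith [Real.pi_gt_three]
        nlinarith
      have : 0 < T ^ 2 := by positivity
      nlinarith
    linarith [neg_abs_le (q R')]
  -- An even and an odd index give the values 1 and -1 of F, with a zero in between.
  obtain ⟨x₁, hx₁, h₁⟩ := hex (2 * (k + 1)) (by omega) (hkey _ (by omega) (by omega))
  obtain ⟨x₂, hx₂, h₂⟩ := hex (2 * (k + 1) + 1) (by omega) (hkey _ (by omega) (by omega))
  rw [pow_mul] at h₁
  rw [pow_succ, pow_mul] at h₂
  norm_num at h₁ h₂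
  set φ : ℝ → ℝ := fun x => (flowF a c ρ ((σ * x : ℝ) : ℂ) T).re with hφ
  have hφc : Continuous φ := Complex.continuous_re.comp
    ((differentiable_flowF a c ρ T).continuous.comp (by fun_prop))
  have hm : (0 : ℝ) ∈ Set.uIcc (φ x₁) (φ x₂) := by
    simp [hφ, h₁, h₂]
  obtain ⟨x, hx, hx0⟩ := intermediate_value_uIcc hφc.continuousOn hm
  have hxR : R' ≤ x := (le_min hx₁ hx₂).trans hx.1
  refine ⟨((σ * x : ℝ) : ℂ), ?_, ?_⟩
  · rw [← ofReal_re_flowF]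
    exact_mod_cast hx0
  · rw [Complex.norm_real, Real.norm_eq_abs, abs_mul, hσ, one_mul]
    exact (le_max_left R 1).trans (hxR.trans (le_abs_self x))

theorem infinite_zeros {a c ρ : ℝ} (ha : 0 < a) (hc : 0 < c) (hρ : ρ ∈ Set.Icc (-1 : ℝ) 1)
    (hdeg : ¬ (ρ = 1 ∧ c = 2 * a)) {T : ℝ} (hT : 0 < T) :
    {z : ℂ | flowF a c ρ z T = 0}.Infinite := by
  intro hfin
  obtain ⟨R, hR⟩ := hfin.isBounded.exists_norm_le
  obtain ⟨z, hz, hzR⟩ := exists_zero_norm_gt ha hc hρ hdeg hT (R + 1)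
  have := hR z hz
  linarith

theorem exists_isZeroEnumeration {a c ρ t : ℝ} (ha : 0 < a) (hc : 0 < c)
    (hρ : ρ ∈ Set.Icc (-1 : ℝ) 1) (hdeg : ¬ (ρ = 1 ∧ c = 2 * a)) (ht : 0 < t) :
    ∃ α : ℕ → ℂ, IsZeroEnumeration a c ρ t α := by
  obtain ⟨α, h1, h2, h3⟩ := exists_monotone_enumeration
    (infinite_zeros ha hc hρ hdeg (half_pos ht)) (finite_zeros_closedBall a c ρ (t / 2))
  exact ⟨α, h1, by simpa only [F_eq_flowF] using h2, h3⟩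

end Heston

/-! ### Growth along the imaginary axis -/

/-- With x = |Re w|, |cosh w| ≤ cosh x and |sinh w| ≥ sinh x, and coth is decreasing; the last fact
is sinh(x - r) ≥ 0. -/
theorem norm_cosh_mul_sinh_le {w : ℂ} {r : ℝ} (hr : 0 < r) (hw : r ≤ |w.re|) :
    ‖Complex.cosh w‖ * Real.sinh r ≤ Real.cosh r * ‖Complex.sinh w‖ := by
  wlog h : 0 ≤ w.re generalizing w with H
  · have := H (w := -w) (by simpa using hw) (by simp; linarith)
    simpa using this
  rw [abs_of_nonneg h] at hw
  have h1 : ‖Complex.cosh w‖ ≤ Real.cosh w.re := by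
    rw [Complex.cosh, norm_div, Complex.norm_ofNat, Real.cosh_eq]
    have := norm_add_le (Complex.exp w) (Complex.exp (-w))
    rw [Complex.norm_exp, Complex.norm_exp, Complex.neg_re] at this
    linarith
  have h2 : Real.sinh w.re ≤ ‖Complex.sinh w‖ := by
    rw [Complex.sinh, norm_div, Complex.norm_ofNat, Real.sinh_eq]
    have := norm_sub_norm_le (Complex.exp w) (Complex.exp (-w))
    rw [Complex.norm_exp, Complex.norm_exp, Complex.neg_re] at this
    linarith
  have h3 : 0 ≤ Real.sinh (w.re - r) := Real.sinh_nonneg_iff.2 (by linarith)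
  rw [Real.sinh_sub] at h3
  have h4 : 0 < Real.sinh r := Real.sinh_pos_iff.2 hr
  have h5 := Real.cosh_pos r
  nlinarith

namespace Heston

theorem p_mul_I (a c ρ y : ℝ) : p a c ρ (y * Complex.I) =
    ((a ^ 2 + (1 - ρ ^ 2) * c ^ 2 * y ^ 2 : ℝ) : ℂ)
      + ((c * (c - 2 * a * ρ) * y : ℝ) : ℂ) * Complex.I := by
  rw [p]
  push_cast
  linear_combination ((ρ : ℂ) ^ 2 - 1) * c ^ 2 * y ^ 2 * Complex.I_sq

/-- If `Re p ≥ r²` then `|F| ≥ r |S|` wherever `a - cρz` has nonnegative real part. -/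
theorem mul_norm_flowS_le_norm_flowF {a c ρ : ℝ} {z : ℂ} {r : ℝ}
    (hp : r ^ 2 ≤ (p a c ρ z).re) (hu : 0 ≤ ((a : ℂ) - c * ρ * z).re) {s : ℝ} (hs : 0 ≤ s) :
    r * ‖flowS a c ρ z s‖ ≤ ‖flowF a c ρ z s‖ := by
  set q := p a c ρ z with hq
  set C : ℝ → ℂ := fun s => coshSqrt (q * (s : ℂ) ^ 2) with hC
  set S : ℝ → ℂ := flowS a c ρ z with hS
  have hCd : ∀ s, HasDerivAt C (q * S s) s := fun s => hasDerivAt_coshSqrt_mul_sq q s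
  have hSd : ∀ s, HasDerivAt S (C s) s := fun s => hasDerivAt_mul_sinhcSqrt_mul_sq q s
  -- φ = Re(C conj S) - r|S|² has derivative (Re p - r²)|S|² + |rS - C|² ≥ 0.
  set φ : ℝ → ℝ := fun s => ((C s).re * (S s).re + (C s).im * (S s).im)
    - r * ((S s).re ^ 2 + (S s).im ^ 2) with hφ
  have hφd : ∀ s, HasDerivAt φ (((q * S s).re * (S s).re + (C s).re * (C s).re
      + ((q * S s).im * (S s).im + (C s).im * (C s).im))
      - r * (2 * (S s).re * (C s).re + 2 * (S s).im * (C s).im)) s := by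
    intro s
    have h1 := (hCd s).complex_re_part
    have h2 := (hCd s).complex_im_part
    have h3 := (hSd s).complex_re_part
    have h4 := (hSd s).complex_im_part
    have h := ((h1.mul h3).add (h2.mul h4)).sub (((h3.pow 2).add (h4.pow 2)).const_mul r)
    refine HasDerivAt.congr_deriv h ?_
    simp
  have hmono : MonotoneOn φ (Set.Icc 0 s) := by
    refine monotoneOn_of_deriv_nonneg (convex_Icc 0 s)
      (fun r _ => (hφd r).continuousAt.continuousWithinAt)
      (fun r _ => (hφd r).differentiableAt.differentiableWithinAt) fun s _ => ?_
    rw [(hφd s).deriv]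
    have h1 := mul_nonneg (sub_nonneg.2 hp)
      (add_nonneg (sq_nonneg (S s).re) (sq_nonneg (S s).im))
    have h2 := add_nonneg (sq_nonneg (r * (S s).re - (C s).re))
      (sq_nonneg (r * (S s).im - (C s).im))
    simp only [Complex.mul_re, Complex.mul_im]
    linear_combination h1 + h2
  have h0 : φ 0 = 0 := by simp [hφ, hS, flowS]
  have hs' : 0 ≤ φ s := h0 ▸ hmono ⟨le_rfl, hs⟩ ⟨hs, le_rfl⟩ hs
  have hF : flowF a c ρ z s = C s + (a - c * ρ * z) * S s := rfl
  set u := (a : ℂ) - c * ρ * z with hu'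
  have hn : ‖S s‖ ^ 2 = (S s).re ^ 2 + (S s).im ^ 2 := by
    rw [Complex.sq_norm, Complex.normSq_apply]; ring
  have h1 : r * ‖S s‖ ^ 2 ≤ ‖flowF a c ρ z s‖ * ‖S s‖ := by
    have h2 := Complex.re_le_norm (flowF a c ρ z s * starRingEnd ℂ (S s))
    rw [norm_mul, Complex.norm_conj] at h2
    refine le_trans ?_ h2
    have h3 : (flowF a c ρ z s * starRingEnd ℂ (S s)).re =
        ((C s).re * (S s).re + (C s).im * (S s).im) + u.re * ((S s).re ^ 2 + (S s).im ^ 2) := by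
      rw [hF]
      simp
      ring
    have h4 : 0 ≤ u.re * ((S s).re ^ 2 + (S s).im ^ 2) := mul_nonneg hu (by positivity)
    rw [h3, hn]
    linarith [hs']
  rcases (norm_nonneg (S s)).eq_or_lt with h | h
  · rw [← h, mul_zero]
    exact norm_nonneg _
  · refine le_of_mul_le_mul_right ?_ h
    linarith

/-- Here Re p(iy) = a² does not grow. Instead |Re P| ≥ a bounds the cosh term by coth(aT)|P||S| with
|P| = O(√y), while the factor a - cρiy has modulus at least cy. -/
theorem eventually_mul_norm_flowS_le_of_sq_eq_one {a c ρ : ℝ} (ha : 0 < a) (hc : 0 < c)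
    (hρ : ρ ^ 2 = 1) {T : ℝ} (hT : 0 < T) (B : ℝ) :
    ∀ᶠ y : ℝ in atTop,
      B * ‖flowS a c ρ (y * Complex.I) T‖ ≤ ‖flowF a c ρ (y * Complex.I) T‖ := by
  set m := c * (c - 2 * a * ρ) with hm
  set K := Real.cosh (a * T) / Real.sinh (a * T) with hK
  -- Chosen so that δ|m| ≤ c/2: after K|P| ≤ δ|P|² + K²/(4δ), half of cy survives.
  set δ := c / (2 * (|m| + 1)) with hδ
  have hδ0 : 0 < δ := by positivity
  have haT : 0 < a * T := by positivity
  filter_upwards [eventually_ge_atTop 0,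
    eventually_ge_atTop ((B + δ * a ^ 2 + K ^ 2 / (4 * δ)) * 2 / c)] with y hy hyB
  obtain ⟨P, hP⟩ : ∃ P : ℂ, P ^ 2 = p a c ρ (y * Complex.I) :=
    IsAlgClosed.exists_pow_nat_eq _ two_pos
  have hpe : p a c ρ (y * Complex.I) = ((a ^ 2 : ℝ) : ℂ) + ((m * y : ℝ) : ℂ) * Complex.I := by
    rw [p_mul_I, hρ, sub_self, zero_mul, zero_mul, add_zero]
  have hre : a ≤ |P.re| := by
    have h1 := congrArg Complex.re (hP.trans hpe)
    rw [pow_two, Complex.mul_re] at h1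
    simp only [Complex.add_re, Complex.mul_re, Complex.ofReal_re, Complex.ofReal_im, Complex.I_re,
      Complex.I_im] at h1
    refine le_of_sq_le_sq ?_ (abs_nonneg _)
    rw [sq_abs]
    nlinarith [mul_self_nonneg P.im]
  have hPn : ‖P‖ ^ 2 ≤ a ^ 2 + |m| * y := by
    rw [← norm_pow, hP, hpe]
    refine (norm_add_le _ _).trans ?_
    rw [norm_mul, Complex.norm_I, mul_one, Complex.norm_real, Complex.norm_real, Real.norm_eq_abs,
      Real.norm_eq_abs, abs_mul, abs_of_nonneg hy, abs_of_nonneg (sq_nonneg a)]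
  set C := coshSqrt (p a c ρ (y * Complex.I) * (T : ℂ) ^ 2) with hC
  set S := flowS a c ρ (y * Complex.I) T with hS
  have hC1 : C = Complex.cosh (P * T) := by rw [hC, ← hP, ← mul_pow, coshSqrt_sq]
  have hS1 : P * S = Complex.sinh (P * T) := by
    rw [hS, flowS, ← hP, ← mul_pow, ← mul_sinhcSqrt_sq]; ring
  have hsinh : 0 < Real.sinh (a * T) := Real.sinh_pos_iff.2 haT
  have hCS : ‖C‖ ≤ K * ‖P‖ * ‖S‖ := by
    have h := norm_cosh_mul_sinh_le (w := P * T) haT (by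
      rw [Complex.mul_re, Complex.ofReal_re, Complex.ofReal_im, mul_zero, sub_zero, abs_mul,
        abs_of_pos hT]
      gcongr)
    rw [← hC1, ← hS1, norm_mul] at h
    rw [hK, mul_assoc, div_mul_eq_mul_div, le_div_iff₀ hsinh]
    exact h
  have hKP : K * ‖P‖ ≤ δ * ‖P‖ ^ 2 + K ^ 2 / (4 * δ) := by
    have h : 0 ≤ (2 * δ * ‖P‖ - K) ^ 2 / (4 * δ) := by positivity
    have h2 : (2 * δ * ‖P‖ - K) ^ 2 / (4 * δ) = δ * ‖P‖ ^ 2 + K ^ 2 / (4 * δ) - K * ‖P‖ := by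
      field_simp; ring
    linarith
  have hδm : δ * |m| ≤ c / 2 := by
    rw [hδ, div_mul_eq_mul_div, div_le_div_iff₀ (by positivity) two_pos]
    nlinarith [abs_nonneg m]
  have hu : c * y ≤ ‖(a : ℂ) - c * ρ * (y * Complex.I)‖ := by
    have h := Complex.abs_im_le_norm ((a : ℂ) - c * ρ * (y * Complex.I))
    refine le_trans (le_of_eq ?_) h
    have hρ1 : |ρ| = 1 := by
      rw [← sq_abs] at hρ
      exact (pow_eq_one_iff_of_nonneg (abs_nonneg ρ) two_ne_zero).1 hρ
    simp [abs_mul, abs_of_pos hc, abs_of_nonneg hy, hρ1]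
  have hF : flowF a c ρ (y * Complex.I) T = C + (a - c * ρ * (y * Complex.I)) * S := rfl
  have hFn : ‖(a : ℂ) - c * ρ * (y * Complex.I)‖ * ‖S‖ - ‖C‖ ≤
      ‖flowF a c ρ (y * Complex.I) T‖ := by
    rw [hF, ← norm_mul, add_comm, sub_le_iff_le_add]
    have := norm_sub_le (((a : ℂ) - c * ρ * (y * Complex.I)) * S + C) C
    rwa [add_sub_cancel_right] at this
  rw [div_le_iff₀ hc] at hyB
  have hmain : B ≤ c * y - K * ‖P‖ := by
    have h1 := mul_le_mul_of_nonneg_left hPn hδ0.le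
    have h2 := mul_le_mul_of_nonneg_right hδm hy
    linarith
  have h3 := mul_le_mul_of_nonneg_right hmain (norm_nonneg S)
  have h4 := mul_le_mul_of_nonneg_right hu (norm_nonneg S)
  linarith

theorem eventually_mul_norm_flowS_le {a c ρ : ℝ} (ha : 0 < a) (hc : 0 < c)
    (hρ : ρ ∈ Set.Icc (-1 : ℝ) 1) {T : ℝ} (hT : 0 < T) (B : ℝ) :
    ∀ᶠ y : ℝ in atTop,
      B * ‖flowS a c ρ (y * Complex.I) T‖ ≤ ‖flowF a c ρ (y * Complex.I) T‖ := by
  by_cases h : ρ ^ 2 = 1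
  · exact eventually_mul_norm_flowS_le_of_sq_eq_one ha hc h hT B
  have hκ : 0 < 1 - ρ ^ 2 :=
    lt_of_le_of_ne (by nlinarith [hρ.1, hρ.2]) fun h' => h (by linarith)
  set κ := √(1 - ρ ^ 2) * c with hκ'
  have hκ0 : 0 < κ := mul_pos (Real.sqrt_pos.2 hκ) hc
  filter_upwards [eventually_ge_atTop (B / κ)] with y hy
  rw [div_le_iff₀ hκ0] at hy
  refine le_trans (mul_le_mul_of_nonneg_right hy (norm_nonneg _)) ?_
  refine mul_norm_flowS_le_norm_flowF ?_ ?_ hT.le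
  · rw [p_mul_I, hκ', mul_pow, mul_pow, Real.sq_sqrt hκ.le]
    simp only [Complex.add_re, Complex.mul_re, Complex.ofReal_re, Complex.ofReal_im, Complex.I_re,
      Complex.I_im]
    nlinarith [sq_nonneg a]
  · simp [ha.le]

theorem tendsto_flow_div_imag {a c ρ : ℝ} (ha : 0 < a) (hc : 0 < c)
    (hρ : ρ ∈ Set.Icc (-1 : ℝ) 1) {T : ℝ} (hT : 0 < T) :
    Tendsto (fun y : ℝ => flowX a c ρ (y * Complex.I) T / flowF a c ρ (y * Complex.I) T
      / (y * Complex.I)) atTop (𝓝 0) := by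
  rw [Metric.tendsto_nhds]
  intro ε hε
  -- As |1 - iy| ≤ 2y, the quotient is at most 2|S|/|F|, and the factor 4/ε makes this at most ε/2.
  filter_upwards [eventually_mul_norm_flowS_le ha hc hρ hT (4 / ε), eventually_ge_atTop 1]
    with y hy hy1
  have hy0 : 0 < y := by linarith
  have hF : 0 < ‖flowF a c ρ (y * Complex.I) T‖ :=
    norm_pos_iff.2 (flowF_ne_zero_of_im_pos hρ (by simpa using hy0) hT.le)
  have h1 : ‖(1 : ℂ) - y * Complex.I‖ ≤ 2 * y := by
    refine (norm_sub_le _ _).trans ?_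
    rw [norm_one, norm_mul, Complex.norm_I, mul_one, Complex.norm_real, Real.norm_eq_abs,
      abs_of_pos hy0]
    linarith
  rw [dist_zero_right, norm_div, norm_div, norm_mul (y : ℂ), Complex.norm_I, mul_one,
    Complex.norm_real, Real.norm_eq_abs, abs_of_pos hy0, flowX, norm_mul, div_div,
    div_lt_iff₀ (by positivity)]
  have h2 := mul_le_mul_of_nonneg_right h1 (norm_nonneg (flowS a c ρ (y * Complex.I) T))
  rw [div_mul_eq_mul_div, div_le_iff₀ hε] at hy
  have h3 : 0 < y * (‖flowF a c ρ (y * Complex.I) T‖ * ε) := by positivity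
  nlinarith

end Heston

/-! ### Entire functions with a bound by 1/|Im z| -/

/-- Removal of a discrete set of singularities at once. -/
theorem differentiable_limUnder_punctured {f : ℂ → ℂ}
    (hd : ∀ c, ∀ᶠ z in 𝓝[≠] c, DifferentiableAt ℂ f z)
    (h0 : ∀ c, Tendsto (fun z => (z - c) * f z) (𝓝[≠] c) (𝓝 0)) :
    Differentiable ℂ fun c => limUnder (𝓝[≠] c) f := by
  intro c
  obtain ⟨r, hr, hball⟩ := Metric.eventually_nhds_iff_ball.1 (eventually_nhdsWithin_iff.1 (hd c))
  have hmem := Metric.ball_mem_nhds c hr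
  have hu := Complex.differentiableOn_update_limUnder_of_isLittleO (f := f) hmem
    (fun z hz => (hball z hz.1 hz.2).differentiableWithinAt) (by
      rw [Asymptotics.isLittleO_iff_tendsto']
      · have h1 : Tendsto (fun z => (z - c) * f z - (z - c) * f c) (𝓝[≠] c)
            (𝓝 (0 - (c - c) * f c)) :=
          (h0 c).sub (Tendsto.mono_left (Continuous.tendsto (by fun_prop) c) nhdsWithin_le_nhds)
        rw [sub_self, zero_mul, sub_zero] at h1
        refine h1.congr fun z => ?_
        rw [div_inv_eq_mul]
        ring
      · filter_upwards [self_mem_nhdsWithin] with z hz h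
        exact absurd (inv_eq_zero.1 h) (sub_ne_zero.2 hz))
  refine (hu.differentiableAt hmem).congr_of_eventuallyEq ?_
  filter_upwards [hmem] with z hz
  rcases eq_or_ne z c with rfl | hzc
  · rw [Function.update_self]
  · rw [Function.update_of_ne hzc]
    exact ((hball z hz hzc).continuousAt.tendsto.mono_left nhdsWithin_le_nhds).limUnder_eq

/-- The factor w² - R² has modulus 2R|Im w| on the circle |w| = R, which cancels the singular bound.
The maximum principle then transfers the estimate to z, where |z| ≤ R/2 keeps the factor at least
3R²/4. -/
theorem norm_le_linear_of_norm_le_div_im {f : ℂ → ℂ} (hf : Differentiable ℂ f) {C : ℝ}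
    (hC : 0 ≤ C) (h : ∀ z : ℂ, z.im ≠ 0 → ‖f z‖ ≤ C * (1 + ‖z‖) ^ 2 / |z.im|) (z : ℂ) :
    ‖f z‖ ≤ 24 * C * (1 + ‖z‖) := by
  set R := 2 * (1 + ‖z‖) with hR
  have hz0 := norm_nonneg z
  have hR2 : 2 ≤ R := by linarith
  have hsphere : ∀ w ∈ frontier (Metric.ball (0 : ℂ) R),
      ‖f w * (w ^ 2 - (R : ℂ) ^ 2)‖ ≤ C * (1 + R) ^ 2 * (2 * R) := by
    intro w hw
    rw [frontier_ball _ (by linarith), mem_sphere_zero_iff_norm] at hw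
    have h1 : w ^ 2 - (R : ℂ) ^ 2 = w * (2 * w.im * Complex.I) := by
      have h2 : (R : ℂ) ^ 2 = w * starRingEnd ℂ w := by
        rw [Complex.mul_conj, Complex.normSq_eq_norm_sq, hw]
        push_cast
        rfl
      have h3 := Complex.sub_conj w
      push_cast at h3
      rw [h2]
      linear_combination w * h3
    rw [norm_mul, h1, norm_mul, norm_mul, norm_mul, Complex.norm_I, hw, Complex.norm_real,
      Complex.norm_ofNat, Real.norm_eq_abs]
    by_cases him : w.im = 0
    · rw [him, abs_zero]
      have : 0 ≤ C * (1 + R) ^ 2 * (2 * R) := by positivity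
      linarith
    · have h4 := h w him
      rw [le_div_iff₀ (abs_pos.2 him), hw] at h4
      calc ‖f w‖ * (R * (2 * |w.im| * 1)) = (‖f w‖ * |w.im|) * (2 * R) := by ring
        _ ≤ C * (1 + R) ^ 2 * (2 * R) := by gcongr
  have hmax := Complex.norm_le_of_forall_mem_frontier_norm_le (U := Metric.ball (0 : ℂ) R)
    Metric.isBounded_ball (f := fun w => f w * (w ^ 2 - (R : ℂ) ^ 2))
    (Differentiable.diffContOnCl (by fun_prop)) hsphere (z := z)
    (subset_closure (mem_ball_zero_iff.2 (by linarith)))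
  rw [norm_mul] at hmax
  have h5 : 3 / 4 * R ^ 2 ≤ ‖z ^ 2 - (R : ℂ) ^ 2‖ := by
    have h6 := norm_sub_norm_le ((R : ℂ) ^ 2) (z ^ 2)
    rw [norm_sub_rev, norm_pow, norm_pow, Complex.norm_real, Real.norm_eq_abs, sq_abs] at h6
    refine le_trans ?_ h6
    nlinarith
  have h7 := mul_le_mul_of_nonneg_left h5 (norm_nonneg (f z))
  have h8 : ‖f z‖ * (3 / 4 * R ^ 2) ≤ (12 * C * R) * (3 / 4 * R ^ 2) := by
    refine (h7.trans hmax).trans ?_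
    have h9 : (1 + R) ^ 2 ≤ 9 / 4 * R ^ 2 := by nlinarith
    have h10 := mul_le_mul_of_nonneg_left h9 hC
    have h11 := mul_le_mul_of_nonneg_right h10 (by linarith : 0 ≤ 2 * R)
    have h12 : 0 ≤ C * R ^ 2 * R := by positivity
    nlinarith
  have h13 := le_of_mul_le_mul_right h8 (by positivity)
  rw [hR] at h13
  linarith

/-- f(z)/z is entire and bounded, hence constant, and its limit along the imaginary axis is 0. -/
theorem eq_zero_of_norm_le_linear {f : ℂ → ℂ} (hf : Differentiable ℂ f) {K : ℝ}
    (h : ∀ z, ‖f z‖ ≤ K * (1 + ‖z‖)) (h0 : f 0 = 0)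
    (hI : Tendsto (fun y : ℝ => f (y * Complex.I) / (y * Complex.I)) atTop (𝓝 0)) (z : ℂ) :
    f z = 0 := by
  have hd : Differentiable ℂ (dslope f 0) := by
    rw [← differentiableOn_univ, Complex.differentiableOn_dslope univ_mem]
    exact hf.differentiableOn
  have hne : ∀ w ≠ 0, dslope f 0 w = f w / w := fun w hw => by
    rw [dslope_of_ne _ hw, slope_def_field, h0, sub_zero, sub_zero]
  have hK : 0 ≤ K := by
    have := (norm_nonneg _).trans (h 0)
    simpa using this
  have hbdd : Bornology.IsBounded (Set.range (dslope f 0)) := by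
    obtain ⟨M, hM⟩ := (isCompact_closedBall (0 : ℂ) 1).exists_bound_of_continuousOn
      hd.continuous.continuousOn
    refine isBounded_iff_forall_norm_le.2 ⟨max M (2 * K), ?_⟩
    rintro _ ⟨w, rfl⟩
    rcases le_total ‖w‖ 1 with hw | hw
    · exact (hM w (by simpa using hw)).trans (le_max_left _ _)
    · refine le_trans ?_ (le_max_right _ _)
      have hw0 : w ≠ 0 := norm_pos_iff.1 (by linarith)
      rw [hne w hw0, norm_div, div_le_iff₀ (by linarith)]
      refine (h w).trans ?_
      nlinarith
  have hconst : ∀ w, dslope f 0 w = dslope f 0 z := fun w => hd.apply_eq_apply_of_bounded hbdd w z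
  have hlim : Tendsto (fun y : ℝ => f (y * Complex.I) / (y * Complex.I)) atTop
      (𝓝 (dslope f 0 z)) := by
    refine tendsto_const_nhds.congr' ?_
    filter_upwards [eventually_gt_atTop 0] with y hy
    rw [← hne _ (by simp [hy.ne']), hconst (y * Complex.I)]
  have hz : dslope f 0 z = 0 := tendsto_nhds_unique hlim hI
  rcases eq_or_ne z 0 with rfl | hz0
  · exact h0
  · rw [hne z hz0, div_eq_zero_iff] at hz
    exact hz.resolve_right hz0

/-! ### Partial fraction series and the expansion -/

/-- The summands of a partial fraction expansion with poles `x n` and weights `b n`. -/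
noncomputable def fractionTerm (x b : ℕ → ℝ) (n : ℕ) (z : ℂ) : ℂ :=
  (b n : ℂ) / ((x n : ℂ) ^ 2 * (1 - z / x n))

section

variable {x b : ℕ → ℝ}

theorem norm_fractionTerm_le (hb : ∀ n, 0 ≤ b n) {n : ℕ} {z : ℂ} {r : ℝ} (hr : 0 < r)
    (h : r ≤ ‖1 - z / (x n : ℂ)‖) : ‖fractionTerm x b n z‖ ≤ r⁻¹ * (b n / x n ^ 2) := by
  rw [fractionTerm, norm_div, norm_mul, norm_pow, Complex.norm_real, Complex.norm_real,
    Real.norm_eq_abs, Real.norm_eq_abs, sq_abs, abs_of_nonneg (hb n), ← div_div, div_eq_inv_mul]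
  have := hb n
  gcongr

theorem norm_fractionTerm_le_of_norm_le (hb : ∀ n, 0 ≤ b n) {n : ℕ} {z : ℂ} {r : ℝ} (hr0 : 0 ≤ r)
    (hr : r < 1) (h : ‖z‖ ≤ r * |x n|) : ‖fractionTerm x b n z‖ ≤ (1 - r)⁻¹ * (b n / x n ^ 2) := by
  refine norm_fractionTerm_le hb (by linarith) ?_
  have h1 := norm_sub_norm_le (1 : ℂ) (z / x n)
  rw [norm_one, norm_div, Complex.norm_real, Real.norm_eq_abs] at h1
  have h2 : ‖z‖ / |x n| ≤ r := div_le_of_le_mul₀ (abs_nonneg _) hr0 h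
  linarith

theorem summable_norm_fractionTerm (hb : ∀ n, 0 ≤ b n) (hx : Tendsto (fun n => |x n|) atTop atTop)
    (hs : Summable fun n => b n / x n ^ 2) (z : ℂ) :
    Summable fun n => ‖fractionTerm x b n z‖ := by
  -- Once |x n| ≥ 2|z|, the denominator satisfies |1 - z/x n| ≥ 1/2.
  refine Summable.of_norm_bounded_eventually_nat (hs.mul_left (1 - 1 / 2 : ℝ)⁻¹) ?_
  filter_upwards [hx.eventually_ge_atTop (2 * ‖z‖)] with n hn
  rw [norm_norm]
  exact norm_fractionTerm_le_of_norm_le hb (by norm_num) (by norm_num) (by linarith)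

theorem differentiableAt_fractionTerm (hx0 : ∀ n, x n ≠ 0) {n : ℕ} {z : ℂ} (hz : z ≠ x n) :
    DifferentiableAt ℂ (fractionTerm x b n) z := by
  have h0 : (x n : ℂ) ≠ 0 := by exact_mod_cast hx0 n
  unfold fractionTerm
  refine DifferentiableAt.div (by fun_prop) (by fun_prop) (mul_ne_zero (pow_ne_zero 2 h0) ?_)
  rw [sub_ne_zero]
  intro h
  exact hz ((div_eq_one_iff_eq h0).1 h.symm)

theorem differentiableOn_tsum_fractionTerm_add (hb : ∀ n, 0 ≤ b n) (hx0 : ∀ n, x n ≠ 0)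
    (hs : Summable fun n => b n / x n ^ 2) {R : ℝ} {N : ℕ}
    (hN : ∀ n, N ≤ n → 2 * R ≤ |x n|) :
    DifferentiableOn ℂ (fun z => ∑' n, fractionTerm x b (n + N) z) (Metric.ball 0 R) := by
  refine Complex.differentiableOn_tsum_of_summable_norm
    (((summable_nat_add_iff N).2 hs).mul_left (1 - 1 / 2 : ℝ)⁻¹) (fun n z hz => ?_)
    Metric.isOpen_ball fun n z hz => ?_
  · refine (differentiableAt_fractionTerm hx0 fun h => ?_).differentiableWithinAt
    have h1 := mem_ball_zero_iff.1 hz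
    have h2 := hN (n + N) (by omega)
    rw [h, Complex.norm_real, Real.norm_eq_abs] at h1
    linarith [abs_nonneg (x (n + N))]
  · refine norm_fractionTerm_le_of_norm_le hb (by norm_num) (by norm_num) ?_
    have h1 := mem_ball_zero_iff.1 hz
    have h2 := hN (n + N) (by omega)
    linarith

/-- Near every point the fraction series is a finite sum plus a holomorphic function. -/
theorem exists_tsum_fractionTerm_eq (hb : ∀ n, 0 ≤ b n) (hx0 : ∀ n, x n ≠ 0)
    (hx : Tendsto (fun n => |x n|) atTop atTop) (hs : Summable fun n => b n / x n ^ 2) (c : ℂ) :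
    ∃ N : ℕ, (∀ n, N ≤ n → (x n : ℂ) ≠ c) ∧ ∃ f : ℂ → ℂ, (∀ᶠ z in 𝓝 c, DifferentiableAt ℂ f z) ∧
      ∀ z, ∑' n, fractionTerm x b n z = ∑ n ∈ Finset.range N, fractionTerm x b n z + f z := by
  set R := ‖c‖ + 1
  obtain ⟨N, hN⟩ := eventually_atTop.1 (hx.eventually_ge_atTop (2 * R))
  have hc := norm_nonneg c
  refine ⟨N, fun n hn h => ?_, fun z => ∑' n, fractionTerm x b (n + N) z, ?_, fun z => ?_⟩
  · have := hN n hn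
    rw [← Real.norm_eq_abs, ← Complex.norm_real, h] at this
    linarith
  · have hd := differentiableOn_tsum_fractionTerm_add hb hx0 hs hN
    have hmem : c ∈ Metric.ball (0 : ℂ) R := mem_ball_zero_iff.2 (lt_add_one _)
    filter_upwards [Metric.isOpen_ball.mem_nhds hmem] with z hz
    exact hd.differentiableAt (Metric.isOpen_ball.mem_nhds hz)
  · exact ((summable_norm_fractionTerm hb hx hs z).of_norm.sum_add_tsum_nat_add N).symm

end

section

variable {x b : ℕ → ℝ}

theorem eventually_forall_ne (hx : Tendsto (fun n => |x n|) atTop atTop) (c : ℂ) :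
    ∀ᶠ z : ℂ in 𝓝[≠] c, ∀ n, z ≠ x n := by
  obtain ⟨N, hN⟩ := eventually_atTop.1 (hx.eventually_ge_atTop (‖c‖ + 1))
  have h1 : ∀ᶠ z : ℂ in 𝓝[≠] c, ∀ n ∈ Finset.range N, z ≠ x n := by
    rw [Finset.eventually_all]
    intro n _
    rcases eq_or_ne (x n : ℂ) c with h | h
    · rw [h]
      exact self_mem_nhdsWithin
    · exact nhdsWithin_le_nhds (isOpen_ne.mem_nhds h.symm)
  have h2 : ∀ᶠ z in 𝓝[≠] c, ‖z‖ < ‖c‖ + 1 :=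
    nhdsWithin_le_nhds (continuous_norm.continuousAt.eventually_lt_const (lt_add_one _))
  filter_upwards [h1, h2] with z hz1 hz2 n hzn
  rcases lt_or_ge n N with hn | hn
  · exact hz1 n (Finset.mem_range.2 hn) hzn
  · have := hN n hn
    rw [hzn, Complex.norm_real, Real.norm_eq_abs] at hz2
    linarith

theorem differentiableAt_tsum_fractionTerm (hb : ∀ n, 0 ≤ b n) (hx0 : ∀ n, x n ≠ 0)
    (hx : Tendsto (fun n => |x n|) atTop atTop) (hs : Summable fun n => b n / x n ^ 2) {z : ℂ}
    (hz : ∀ n, z ≠ x n) : DifferentiableAt ℂ (fun z => ∑' n, fractionTerm x b n z) z := by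
  obtain ⟨N, -, f, hf, hsum⟩ := exists_tsum_fractionTerm_eq hb hx0 hx hs z
  rw [funext hsum]
  exact (DifferentiableAt.fun_sum fun n _ => differentiableAt_fractionTerm hx0 (hz n)).add
    hf.self_of_nhds

theorem sub_mul_fractionTerm_self {n : ℕ} (h0 : x n ≠ 0) {z : ℂ} (hz : z ≠ x n) :
    (z - x n) * fractionTerm x b n z = -(b n / x n) := by
  have h1 : (x n : ℂ) ≠ 0 := by exact_mod_cast h0
  have h2 : (x n : ℂ) - z ≠ 0 := sub_ne_zero.2 hz.symm
  have h3 : (1 : ℂ) - z / x n = (x n - z) / x n := by field_simp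
  rw [fractionTerm, h3]
  field_simp
  ring

/-- Only the m-th term is singular at x m; multiplied by z - x m it is the constant -b m/x m, and
the factor z supplies x m. -/
theorem tendsto_sub_mul_tsum_fractionTerm (hb : ∀ n, 0 ≤ b n) (hx0 : ∀ n, x n ≠ 0)
    (hinj : Function.Injective x)
    (hx : Tendsto (fun n => |x n|) atTop atTop) (hs : Summable fun n => b n / x n ^ 2) (m : ℕ) :
    Tendsto (fun z => (z - x m) * (z * ∑' n, fractionTerm x b n z)) (𝓝[≠] (x m : ℂ))
      (𝓝 (-b m)) := by
  obtain ⟨N, hN, f, hf, hsum⟩ := exists_tsum_fractionTerm_eq hb hx0 hx hs (x m)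
  have hm : m ∈ Finset.range N := by
    rw [Finset.mem_range]
    by_contra! h
    exact hN m h rfl
  set r : ℂ → ℂ := fun z => ∑ n ∈ (Finset.range N).erase m, fractionTerm x b n z + f z with hr
  have hrc : ContinuousAt r (x m) := by
    refine ((DifferentiableAt.fun_sum fun n hn => differentiableAt_fractionTerm hx0 ?_).add
      hf.self_of_nhds).continuousAt
    intro h
    exact (Finset.mem_erase.1 hn).1 (hinj (by exact_mod_cast h.symm))
  have h1 : ContinuousAt (fun z : ℂ => -(z * (b m / x m)) + (z - x m) * (z * r z)) (x m) := by
    fun_prop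
  have h2 := h1.tendsto.mono_left (nhdsWithin_le_nhds (s := {(x m : ℂ)}ᶜ))
  have h0 : (x m : ℂ) ≠ 0 := by exact_mod_cast hx0 m
  rw [sub_self, zero_mul, add_zero, mul_div_cancel₀ _ h0] at h2
  refine h2.congr' ?_
  filter_upwards [self_mem_nhdsWithin] with z hz
  rw [hsum, ← Finset.add_sum_erase _ _ hm, add_assoc]
  linear_combination -z * sub_mul_fractionTerm_self (b := b) (hx0 m) hz

/-- For real x, |1 - z/x| is at least the distance |Im z|/|z| from 1 to the line ℝz. -/
theorem norm_mul_tsum_fractionTerm_le (hb : ∀ n, 0 ≤ b n) (hx0 : ∀ n, x n ≠ 0)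
    (hs : Summable fun n => b n / x n ^ 2) {z : ℂ} (hz : z.im ≠ 0) :
    ‖z * ∑' n, fractionTerm x b n z‖ ≤ (∑' n, b n / x n ^ 2) * ‖z‖ ^ 2 / |z.im| := by
  have him : 0 < |z.im| := abs_pos.2 hz
  have hz0 : 0 < ‖z‖ := norm_pos_iff.2 fun h => hz (by rw [h]; rfl)
  have hterm : ∀ n, ‖fractionTerm x b n z‖ ≤ (|z.im| / ‖z‖)⁻¹ * (b n / x n ^ 2) := by
    intro n
    refine norm_fractionTerm_le hb (by positivity) ?_
    have h0 : (x n : ℂ) ≠ 0 := by exact_mod_cast hx0 n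
    have h1 : ‖1 - z / (x n : ℂ)‖ * |x n| = ‖(x n : ℂ) - z‖ := by
      rw [← Real.norm_eq_abs, ← Complex.norm_real, ← norm_mul]
      congr 1
      field_simp
    have h2 : |x n| * |z.im| ≤ ‖(x n : ℂ) - z‖ * ‖z‖ := by
      have h3 := Complex.abs_im_le_norm (((x n : ℂ) - z) * starRingEnd ℂ z)
      rw [norm_mul, Complex.norm_conj] at h3
      refine le_trans (le_of_eq ?_) h3
      rw [← abs_mul, ← abs_neg]
      congr 1
      simp
      ring
    rw [div_le_iff₀ hz0]
    refine le_of_mul_le_mul_right ?_ (abs_pos.2 (hx0 n))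
    linear_combination h2 - ‖z‖ * h1
  have h := tsum_of_norm_bounded (hs.mul_left (|z.im| / ‖z‖)⁻¹).hasSum hterm
  rw [tsum_mul_left] at h
  rw [norm_mul]
  refine (mul_le_mul_of_nonneg_left h hz0.le).trans (le_of_eq ?_)
  field_simp

/-- On the imaginary axis |1 - iy/x| ≥ 1, so b n/x n² dominates every term, and each term tends to
0. -/
theorem tendsto_tsum_fractionTerm_imag (hb : ∀ n, 0 ≤ b n) (hx0 : ∀ n, x n ≠ 0)
    (hs : Summable fun n => b n / x n ^ 2) :
    Tendsto (fun y : ℝ => ∑' n, fractionTerm x b n (y * Complex.I)) atTop (𝓝 0) := by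
  have h := tendsto_tsum_of_dominated_convergence (𝓕 := atTop)
    (f := fun (y : ℝ) n => fractionTerm x b n (y * Complex.I)) (g := fun _ => (0 : ℂ)) hs ?_ ?_
  · simpa using h
  · intro n
    have h0 := abs_pos.2 (hx0 n)
    refine squeeze_zero_norm' (a := fun y => (|x n| * (b n / x n ^ 2)) * y⁻¹) ?_ ?_
    · filter_upwards [eventually_gt_atTop 0] with y hy
      refine (norm_fractionTerm_le hb (div_pos hy h0) ?_).trans (le_of_eq ?_)
      · have h1 := Complex.abs_im_le_norm (1 - y * Complex.I / (x n : ℂ))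
        rw [mul_div_right_comm, ← Complex.ofReal_div] at h1 ⊢
        refine le_trans (le_of_eq ?_) h1
        nth_rw 1 [← abs_of_pos hy]
        rw [← abs_div]
        simp
      · rw [inv_div]; ring
    · simpa using tendsto_inv_atTop_zero.const_mul (|x n| * (b n / x n ^ 2))
  · filter_upwards with y n
    have h1 := norm_fractionTerm_le hb one_pos (n := n) (x := x) (z := y * Complex.I) ?_
    · simpa using h1
    · have h1 := Complex.abs_re_le_norm (1 - y * Complex.I / (x n : ℂ))
      rw [mul_div_right_comm, ← Complex.ofReal_div] at h1 ⊢
      simpa using h1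

/-- Partial fraction expansion of a function with simple real poles of nonnegative residue, under
the growth conditions satisfied by (negatives of) meromorphic Herglotz functions without linear
part. -/
theorem eq_sub_mul_tsum_fractionTerm {g : ℂ → ℂ} (hb : ∀ n, 0 ≤ b n) (hx0 : ∀ n, x n ≠ 0)
    (hinj : Function.Injective x)
    (hx : Tendsto (fun n => |x n|) atTop atTop) (hs : Summable fun n => b n / x n ^ 2)
    (hg : ∀ z : ℂ, (∀ n, z ≠ x n) → DifferentiableAt ℂ g z)
    (hres : ∀ n, Tendsto (fun z => (z - x n) * g z) (𝓝[≠] (x n : ℂ)) (𝓝 (b n)))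
    {C : ℝ} (hC : 0 ≤ C) (hbd : ∀ z : ℂ, z.im ≠ 0 → ‖g z‖ ≤ C * (1 + ‖z‖) ^ 2 / |z.im|)
    (hI : Tendsto (fun y : ℝ => g (y * Complex.I) / (y * Complex.I)) atTop (𝓝 0))
    {z : ℂ} (hz : ∀ n, z ≠ x n) :
    g z = g 0 - z * ∑' n, fractionTerm x b n z := by
  set E : ℂ → ℂ := fun z => g z - g 0 + z * ∑' n, fractionTerm x b n z with hE
  have hEd : ∀ z : ℂ, (∀ n, z ≠ x n) → DifferentiableAt ℂ E z := fun z hz =>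
    ((hg z hz).sub_const _).add
      (differentiableAt_id.mul (differentiableAt_tsum_fractionTerm hb hx0 hx hs hz))
  have hE0 : ∀ c, Tendsto (fun z => (z - c) * E z) (𝓝[≠] c) (𝓝 0) := by
    intro c
    by_cases hc : ∃ n, c = x n
    · obtain ⟨n, rfl⟩ := hc
      have h1 : Tendsto (fun z : ℂ => (z - x n) * g 0) (𝓝[≠] (x n : ℂ))
          (𝓝 ((x n - x n) * g 0)) :=
        Tendsto.mono_left (Continuous.tendsto (by fun_prop) _) nhdsWithin_le_nhds
      have h2 := ((hres n).sub h1).add (tendsto_sub_mul_tsum_fractionTerm hb hx0 hinj hx hs n)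
      rw [sub_self, zero_mul, sub_zero, add_neg_cancel] at h2
      refine h2.congr fun z => ?_
      rw [hE]
      ring
    · push Not at hc
      have h1 : ContinuousAt (fun z => (z - c) * E z) c :=
        (continuousAt_id.sub continuousAt_const).mul (hEd c hc).continuousAt
      have h2 := h1.tendsto.mono_left (nhdsWithin_le_nhds (s := {c}ᶜ))
      rwa [sub_self, zero_mul] at h2
  -- The residues cancel in E, so its singularities are removable; H fills them in.
  set H : ℂ → ℂ := fun c => limUnder (𝓝[≠] c) E with hH
  have hHd : Differentiable ℂ H := differentiable_limUnder_punctured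
    (fun c => (eventually_forall_ne hx c).mono hEd) hE0
  have hEq : ∀ z : ℂ, (∀ n, z ≠ x n) → H z = E z := fun z hz =>
    ((hEd z hz).continuousAt.tendsto.mono_left nhdsWithin_le_nhds).limUnder_eq
  have hreal : ∀ z : ℂ, z.im ≠ 0 → ∀ n, z ≠ x n := by
    rintro z hz n rfl
    exact hz (Complex.ofReal_im _)
  have hB : 0 ≤ ∑' n, b n / x n ^ 2 := tsum_nonneg fun n => div_nonneg (hb n) (sq_nonneg _)
  have hbound : ∀ z : ℂ, z.im ≠ 0 →
      ‖H z‖ ≤ (C + ‖g 0‖ + ∑' n, b n / x n ^ 2) * (1 + ‖z‖) ^ 2 / |z.im| := by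
    intro z hz
    have him : 0 < |z.im| := abs_pos.2 hz
    have hzn := norm_nonneg z
    rw [hEq z (hreal z hz)]
    have h1 : ‖g 0‖ ≤ ‖g 0‖ * (1 + ‖z‖) ^ 2 / |z.im| := by
      rw [le_div_iff₀ him]
      refine mul_le_mul_of_nonneg_left ?_ (norm_nonneg _)
      nlinarith [Complex.abs_im_le_norm z]
    have h2 : ‖z * ∑' n, fractionTerm x b n z‖ ≤
        (∑' n, b n / x n ^ 2) * (1 + ‖z‖) ^ 2 / |z.im| := by
      refine (norm_mul_tsum_fractionTerm_le hb hx0 hs hz).trans ?_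
      gcongr
      linarith
    refine (norm_add_le _ _).trans ((add_le_add ((norm_sub_le _ _).trans
      (add_le_add (hbd z hz) h1)) h2).trans (le_of_eq ?_))
    ring
  have hx0' : ∀ n, (0 : ℂ) ≠ x n := fun n h => hx0 n (by exact_mod_cast h.symm)
  have hzero : H z = 0 := by
    refine eq_zero_of_norm_le_linear hHd
      (norm_le_linear_of_norm_le_div_im hHd (by positivity) hbound) ?_ ?_ z
    · rw [hEq 0 hx0', hE]
      simp
    · have h1 : Tendsto (fun y : ℝ => g 0 / (y * Complex.I)) atTop (𝓝 0) := by
        rw [tendsto_zero_iff_norm_tendsto_zero]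
        refine (tendsto_abs_atTop_atTop.const_div_atTop ‖g 0‖).congr fun y => ?_
        simp
      have h2 := (hI.sub h1).add (tendsto_tsum_fractionTerm_imag hb hx0 hs)
      rw [sub_zero, add_zero] at h2
      refine h2.congr' ?_
      filter_upwards [eventually_gt_atTop 0] with y hy
      have hy0 : (y * Complex.I : ℂ) ≠ 0 := by simp [hy.ne']
      rw [hEq _ (hreal _ (by simp [hy.ne'])), hE, add_div, sub_div, mul_div_cancel_left₀ _ hy0]
  rw [hEq z hz, hE] at hzero
  linear_combination hzero

theorem tendstoUniformlyOn_sum_fractionTerm (hb : ∀ n, 0 ≤ b n)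
    (hs : Summable fun n => b n / x n ^ 2) {r : ℝ} (hr : ∀ n, r ≤ |x n|) {K : Set ℂ}
    (hK : IsCompact K) (hKr : K ⊆ Metric.ball 0 r) :
    TendstoUniformlyOn (fun (N : ℕ) z => ∑ n ∈ Finset.range N, fractionTerm x b n z)
      (fun z => ∑' n, fractionTerm x b n z) atTop K := by
  rcases K.eq_empty_or_nonempty with rfl | hne
  · exact tendstoUniformlyOn_empty
  obtain ⟨w, hw, hmax⟩ := hK.exists_isMaxOn hne continuous_norm.continuousOn
  have hwr : ‖w‖ < r := by simpa using hKr hw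
  have hr0 : 0 < r := (norm_nonneg w).trans_lt hwr
  -- Weierstrass test with ratio ‖w‖/r < 1, where w has maximal norm in K.
  refine tendstoUniformlyOn_tsum_nat (hs.mul_left (1 - ‖w‖ / r)⁻¹) fun n z hz => ?_
  refine norm_fractionTerm_le_of_norm_le hb (by positivity) ((div_lt_one hr0).2 hwr) ?_
  have h1 : ‖z‖ ≤ ‖w‖ := hmax hz
  rw [div_mul_eq_mul_div, le_div_iff₀ hr0]
  exact mul_le_mul h1 (hr n) hr0.le (norm_nonneg w)

end

/-! ### Simple poles of a quotient and the main theorem -/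

theorem meromorphicOrderAt_div_of_simple_zero {f h : ℂ → ℂ} (hf : Differentiable ℂ f)
    (hh : Differentiable ℂ h) {x : ℂ} (hhx : h x = 0) (hfx : f x ≠ 0) (hd : deriv h x ≠ 0) :
    meromorphicOrderAt (fun z => f z / h z) x = -1 := by
  have hfa : AnalyticAt ℂ f x := hf.analyticAt x
  have hha : AnalyticAt ℂ h x := hh.analyticAt x
  have hda : AnalyticAt ℂ (dslope h x) x := by
    have : Differentiable ℂ (dslope h x) := by
      rw [← differentiableOn_univ, Complex.differentiableOn_dslope univ_mem]
      exact hh.differentiableOn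
    exact this.analyticAt x
  have hdx : dslope h x x ≠ 0 := by rwa [dslope_same]
  have hm : MeromorphicAt (fun z => f z / h z) x := hfa.meromorphicAt.div hha.meromorphicAt
  refine (meromorphicOrderAt_eq_int_iff (n := -1) hm).2
    ⟨fun z => f z / dslope h x z, hfa.div hda hdx, div_ne_zero hfx hdx, ?_⟩
  filter_upwards [self_mem_nhdsWithin] with z hz
  rw [dslope_of_ne _ hz, slope_def_field, hhx, sub_zero, smul_eq_mul, zpow_neg_one, div_div_eq_mul_div,
    mul_div_assoc', inv_mul_eq_div, mul_div_cancel_right₀ _ (sub_ne_zero.2 hz)]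

theorem tendsto_sub_mul_div_of_simple_zero {f h : ℂ → ℂ} {x : ℂ} (hf : ContinuousAt f x)
    (hh : DifferentiableAt ℂ h x) (hhx : h x = 0) (hd : deriv h x ≠ 0) :
    Tendsto (fun z => (z - x) * (f z / h z)) (𝓝[≠] x) (𝓝 (f x / deriv h x)) := by
  have h1 := hasDerivAt_iff_tendsto_slope.1 hh.hasDerivAt
  refine ((hf.tendsto.mono_left nhdsWithin_le_nhds).div h1 hd).congr' ?_
  filter_upwards [self_mem_nhdsWithin] with z hz
  rw [Pi.div_apply, slope_def_field, hhx, sub_zero, div_div_eq_mul_div]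
  ring

namespace Heston

theorem flow_div_at_zero {a c ρ : ℝ} (ha : a ≠ 0) (t : ℝ) :
    flowX a c ρ 0 (t / 2) / flowF a c ρ 0 (t / 2) =
      1 / (2 * a) * (1 - Complex.exp (-(a * t))) := by
  have ha' : (a : ℂ) ≠ 0 := by exact_mod_cast ha
  have h1 : Complex.exp (-(a * t)) =
      Complex.exp (-(a * (t / 2 : ℝ))) / Complex.exp (a * (t / 2 : ℝ)) := by
    rw [← Complex.exp_sub]
    congr 1
    push_cast
    ring
  have h2 := Complex.exp_ne_zero (a * (t / 2 : ℝ))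
  rw [flowX_at_zero ha, flowF_at_zero, h1, Complex.sinh]
  field_simp

theorem tendsto_abs_atTop_of_zeros {a c ρ T : ℝ} {x : ℕ → ℝ} (hinj : Function.Injective x)
    (hx : ∀ n, flowF a c ρ (x n) T = 0) : Tendsto (fun n => |x n|) atTop atTop := by
  have hinj' : Function.Injective fun n => (x n : ℂ) := Complex.ofReal_injective.comp hinj
  rw [← Nat.cofinite_eq_atTop, tendsto_atTop]
  intro R
  rw [eventually_cofinite]
  refine ((finite_zeros_closedBall a c ρ T R).preimage hinj'.injOn).subset fun n hn => ?_
  refine ⟨hx n, ?_⟩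
  rw [Set.mem_ofPred_eq, not_le] at hn
  simpa using hn.le

theorem IsZeroEnumeration.exists_ofReal {a c ρ t : ℝ} (hρ : ρ ∈ Set.Icc (-1 : ℝ) 1) (ht : 0 < t)
    {α : ℕ → ℂ} (hα : IsZeroEnumeration a c ρ t α) :
    ∃ x : ℕ → ℝ, α = (fun n => (x n : ℂ)) ∧ ∀ n, flowF a c ρ (x n) (t / 2) = 0 := by
  have hzero : ∀ n, flowF a c ρ (α n) (t / 2) = 0 := fun n => by
    have : α n ∈ {z : ℂ | F a c ρ t z = 0} := hα.range_eq ▸ Set.mem_range_self n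
    rwa [Set.mem_ofPred_eq, F_eq_flowF] at this
  have him : ∀ n, (((α n).re : ℝ) : ℂ) = α n := fun n => by
    refine Complex.ext rfl ?_
    by_contra h
    exact flowF_ne_zero_of_im_ne_zero hρ (z := α n) (Ne.symm h) (half_pos ht).le (hzero n)
  exact ⟨fun n => (α n).re, funext fun n => (him n).symm, fun n => by rw [him n]; exact hzero n⟩

end Heston

theorem theorem5p3 (a c ρ t : ℝ) (ha : 0 < a) (hc : 0 < c) (hρ : ρ ∈ Set.Icc (-1 : ℝ) 1)
    (ht : 0 < t) (hdeg : ¬ (ρ = 1 ∧ c = 2 * a)) :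
    -- `G` is meromorphic, and the zeros of `F` form an infinite sequence of nonzero numbers
    MeromorphicOn (Heston.G a c ρ t) Set.univ ∧
    Heston.F a c ρ t 0 ≠ 0 ∧
    (∃ α : ℕ → ℂ, Heston.IsZeroEnumeration a c ρ t α) ∧
    ∀ α : ℕ → ℂ, Heston.IsZeroEnumeration a c ρ t α →
      -- the zeros of `F` are real and simple
      (∀ n, (α n).im = 0 ∧ deriv (Heston.F a c ρ t) (α n) ≠ 0) ∧
      ∃ b : ℕ → ℝ,
        (∀ n, 0 < b n) ∧
        -- `b n` is the residue of `G` at its simple pole `α n`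
        (∀ n, meromorphicOrderAt (Heston.G a c ρ t) (α n) = -1 ∧
          Tendsto (fun z : ℂ => (z - α n) * Heston.G a c ρ t z) (𝓝[≠] (α n)) (𝓝 (b n : ℂ))) ∧
        Summable (fun n => b n / (α n).re ^ 2) ∧
        (∀ z : ℂ, (∀ n, z ≠ α n) →
          Summable (fun n => (b n : ℂ) / (α n ^ 2 * (1 - z / α n))) ∧
          Heston.G a c ρ t z = 1 / (2 * a) * (1 - Complex.exp (-(a * t))) -
            z * ∑' n, (b n : ℂ) / (α n ^ 2 * (1 - z / α n))) ∧
        -- locally uniform convergence of the partial sums in the disc `|z| < |α 0|`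
        (∀ K : Set ℂ, IsCompact K → K ⊆ Metric.ball 0 ‖α 0‖ →
          TendstoUniformlyOn
            (fun (N : ℕ) (z : ℂ) => ∑ n ∈ Finset.range N, (b n : ℂ) / (α n ^ 2 * (1 - z / α n)))
            (fun z : ℂ => ∑' n, (b n : ℂ) / (α n ^ 2 * (1 - z / α n))) atTop K) := by
  have hT : 0 < t / 2 := half_pos ht
  have hX := Heston.differentiable_flowX a c ρ (t / 2)
  have hF := Heston.differentiable_flowF a c ρ (t / 2)
  have hFeq : Heston.F a c ρ t = fun z => Heston.flowF a c ρ z (t / 2) :=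
    funext (Heston.F_eq_flowF a c ρ t)
  have hGeq : Heston.G a c ρ t =
      fun z => Heston.flowX a c ρ z (t / 2) / Heston.flowF a c ρ z (t / 2) :=
    funext (Heston.G_eq_flow a c ρ t)
  have hF0 : Heston.flowF a c ρ 0 (t / 2) ≠ 0 := Heston.flowF_zero_ne_zero a c ρ (t / 2)
  refine ⟨fun z _ => ?_, ?_, Heston.exists_isZeroEnumeration ha hc hρ hdeg ht, fun α hα => ?_⟩
  · rw [hGeq]
    exact (hX.analyticAt z).meromorphicAt.div (hF.analyticAt z).meromorphicAt
  · rwa [hFeq]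
  obtain ⟨x, rfl, hx⟩ := hα.exists_ofReal hρ ht
  have hinj : Function.Injective x := fun m n hmn => hα.injective (congrArg Complex.ofReal hmn)
  have hx0 : ∀ n, x n ≠ 0 := fun n h => hF0 (by simpa [h] using hx n)
  have htend := Heston.tendsto_abs_atTop_of_zeros hinj hx
  set b : ℕ → ℝ := fun n => Heston.residue a c ρ (t / 2) (x n) with hb
  have hbpos : ∀ n, 0 < b n := fun n => Heston.residue_pos hρ hT (hx n)
  have hsum : Summable fun n => b n / x n ^ 2 :=
    summable_of_sum_le (fun n => div_nonneg (hbpos n).le (sq_nonneg _))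
      (Heston.sum_residue_div_sq_le hρ hT hF0 hinj hx)
  have hne := fun n => Heston.flowX_and_deriv_ne_zero hρ hT (hx n)
  have hres : ∀ n, Tendsto (fun z : ℂ => (z - x n) * Heston.G a c ρ t z) (𝓝[≠] (x n : ℂ))
      (𝓝 (b n : ℂ)) := fun n => by
    rw [hb, hGeq, Heston.ofReal_residue hρ hT (hx n)]
    exact tendsto_sub_mul_div_of_simple_zero hX.continuous.continuousAt (hF _) (hx n) (hne n).2
  refine ⟨fun n => ⟨Complex.ofReal_im _, by rw [hFeq]; exact (hne n).2⟩, b, hbpos,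
    fun n => ⟨?_, hres n⟩, by simpa using hsum, fun z hz => ⟨?_, ?_⟩, fun K hK hKb => ?_⟩
  · rw [hGeq]
    exact meromorphicOrderAt_div_of_simple_zero hX hF (hx n) (hne n).1 (hne n).2
  · exact (summable_norm_fractionTerm (fun n => (hbpos n).le) htend hsum z).of_norm
  · have hzeros : ∀ w : ℂ, (∀ n, w ≠ x n) → Heston.flowF a c ρ w (t / 2) ≠ 0 := by
      intro w hw h
      have : w ∈ {z : ℂ | Heston.F a c ρ t z = 0} := by rwa [hFeq]
      rw [← hα.range_eq] at this
      obtain ⟨n, hn⟩ := this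
      exact hw n hn.symm
    rw [← Heston.flow_div_at_zero (ρ := ρ) (c := c) ha.ne', ← Heston.G_eq_flow]
    -- The growth constant is the exponential factor of the Lyapunov bound, with |w - 1| ≤ 1 + |w|.
    refine eq_sub_mul_tsum_fractionTerm (fun n => (hbpos n).le) hx0 hinj htend hsum
      (fun w hw => ?_) hres (Real.exp_nonneg ((2 * |c * ρ - a| + 1) * (t / 2))) (fun w hw => ?_)
      ?_ hz
    · rw [hGeq]
      exact (hX w).div (hF w) (hzeros w hw)
    · rw [Heston.G_eq_flow]
      refine (Heston.norm_flow_div_le hρ hw hT.le).trans ?_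
      have h1 := norm_sub_le w 1
      rw [norm_one, add_comm] at h1
      gcongr
    · simpa only [Heston.G_eq_flow] using Heston.tendsto_flow_div_imag ha hc hρ hT
  · refine tendstoUniformlyOn_sum_fractionTerm (fun n => (hbpos n).le) hsum (fun n => ?_) hK hKb
    have := hα.monotone_norm (Nat.zero_le n)
    simpa using this
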